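/- All graphs are finite and simple. A realisation $p\colon V(G)\to\mathbb{R}^2$ is generic if its coordinates are algebraically independent over $\mathbb{Q}$. A continuous motion of $(G,p)$ is a continuous map $\phi\colon(-1,1)\times V(G)\to\mathbb{R}^2$ such that $\phi_0=p$ and every $\phi_t$ gives all edges of $G$ the same lengths as $p$; it is trivial if, for every $t$, all pairs of vertices have the same distance in $\phi_t$ as in $p$. The framework $(G,p)$ is flexible if it has a non-trivial continuous motion, and rigid otherwise; $G$ is rigid (flexible) if its generic realisations in $\mathbb{R}^2$ are rigid (flexible). $G$ is minimally rigid if $G$ is rigid but $G-e$ is flexible for every $e\in E(G)$. A NAC-colouring of $G$ is a surjective map $c\colon E(G)\to\{\mathrm{red},\mathrm{blue}\}$ such that every cycle of $G$ is either monochromatic or contains at least two red and at least two blue edges; $\nu(G)$ denotes the number of NAC-colourings of $G$ divided by $2$. Let $H$ be the graph on the vertices $0,1,\dots,17$ with the $33$ edges $\{0,1\}$, $\{0,5\}$, $\{0,9\}$, $\{1,2\}$, $\{1,4\}$, $\{1,6\}$, $\{1,10\}$, $\{1,11\}$, $\{1,12\}$, $\{1,14\}$, $\{1,16\}$, $\{2,3\}$,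 $\{2,5\}$, $\{3,4\}$, $\{3,8\}$, $\{3,11\}$, $\{4,5\}$, $\{5,6\}$, $\{5,10\}$, $\{5,11\}$, $\{5,12\}$, $\{5,14\}$, $\{5,16\}$, $\{6,7\}$, $\{7,8\}$, $\{8,9\}$, $\{8,13\}$, $\{8,15\}$, $\{8,17\}$, $\{9,10\}$, $\{12,13\}$, $\{14,15\}$, $\{16,17\}$. **Corollary 5.6.** There is an infinite family of minimally rigid graphs $H_k$ with $\nu(H_k)=\omega\bigl(2.13^{|V(H_k)|}\bigr)$. More precisely, $H$ is minimally rigid and $\nu(H)=180607$. Moreover, let $ab$ be any edge of $H$ and, for $k\ge 1$, let $H_k$ be obtained by gluing $k$ copies of $H$ along $ab$ (that is, from $k$ disjoint copies of $H$ by identifying all copies of $a$ with each other and all copies of $b$ with each other). Then, for every $k\ge1$, $H_k$ is minimally rigid, $|V(H_k)|=16k+2$ and $\nu(H_k)=(\nu(H)+1)^k-1$; and $$\lim_{k\to\infty}\frac{\nu(H_k)}{2.13^{|V(H_k)|}}=\infty .$$ -/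

import Mathlib

open Filter Asymptotics

/-! ### Rigidity -/

/-- A realisation of the vertex set `V` in Euclidean `d`-space. -/
abbrev Realisation (V : Type*) (d : ℕ) : Type _ := V → EuclideanSpace ℝ (Fin d)

/-- Two realisations of `G` are equivalent if all edges have the same lengths in both. -/
def RealisationEquivalent {V : Type*} {d : ℕ} (G : SimpleGraph V) (p q : Realisation V d) : Prop :=
  ∀ u v : V, G.Adj u v → ‖p u - p v‖ = ‖q u - q v‖

/-- Two realisations are congruent if all pairs of vertices have the same distances in both. -/
def RealisationCongruent {V : Type*} {d : ℕ} (p q : Realisation V d) : Prop :=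
  ∀ u v : V, ‖p u - p v‖ = ‖q u - q v‖

/-- `φ`, restricted to times in `(-1, 1)`, is a continuous motion of the framework `(G, p)`. -/
def IsContinuousMotion {V : Type*} {d : ℕ} (G : SimpleGraph V) (p : Realisation V d)
    (φ : ℝ → Realisation V d) : Prop :=
  (∀ v : V, ContinuousOn (fun t => φ t v) (Set.Ioo (-1) 1)) ∧ φ 0 = p ∧
    ∀ t ∈ Set.Ioo (-1 : ℝ) 1, RealisationEquivalent G p (φ t)

/-- A framework is flexible if it has a non-trivial continuous motion. -/
def FlexibleFramework {V : Type*} {d : ℕ} (G : SimpleGraph V) (p : Realisation V d) : Prop :=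
  ∃ φ : ℝ → Realisation V d, IsContinuousMotion G p φ ∧
    ¬ ∀ t ∈ Set.Ioo (-1 : ℝ) 1, RealisationCongruent p (φ t)

/-- A framework is rigid if it is not flexible. -/
def RigidFramework {V : Type*} {d : ℕ} (G : SimpleGraph V) (p : Realisation V d) : Prop :=
  ¬ FlexibleFramework G p

/-- A realisation is generic if its coordinates are algebraically independent over `ℚ`. -/
def GenericRealisation {V : Type*} {d : ℕ} (p : Realisation V d) : Prop :=
  AlgebraicIndependent ℚ (fun x : V × Fin d => p x.1 x.2)

/-- `G` is `d`-rigid if its generic realisations in `d`-space are rigid. -/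
def IsRigidGraph {V : Type*} (d : ℕ) (G : SimpleGraph V) : Prop :=
  ∀ p : Realisation V d, GenericRealisation p → RigidFramework G p

/-- `G` is `d`-flexible if its generic realisations in `d`-space are flexible. -/
def IsFlexibleGraph {V : Type*} (d : ℕ) (G : SimpleGraph V) : Prop :=
  ∀ p : Realisation V d, GenericRealisation p → FlexibleFramework G p

/-- `G` is minimally rigid (in the plane) if it is `2`-rigid, but deleting any edge makes it
`2`-flexible. -/
def IsMinimallyRigid {V : Type*} (G : SimpleGraph V) : Prop :=
  IsRigidGraph 2 G ∧ ∀ e ∈ G.edgeSet, IsFlexibleGraph 2 (G.deleteEdges {e})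

/-! ### NAC-colourings -/

/-- The edges of colour `b` on the closed walk `w`, for an edge colouring `c`. -/
def colouredEdges {V : Type*} {G : SimpleGraph V} (c : G.edgeSet → Bool) {v : V}
    (w : G.Walk v v) (b : Bool) : Set G.edgeSet :=
  {e | (e : Sym2 V) ∈ w.edges ∧ c e = b}

/-- A NAC-colouring of `G` is a surjective colouring of the edges with two colours
(`true` is red and `false` is blue) such that every cycle is either monochromatic or has at
least two edges of both colours. -/
def IsNACColouring {V : Type*} (G : SimpleGraph V) (c : G.edgeSet → Bool) : Prop :=
  Function.Surjective c ∧
    ∀ (v : V) (w : G.Walk v v), w.IsCycle →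
      (∃ b : Bool, ∀ e : G.edgeSet, (e : Sym2 V) ∈ w.edges → c e = b) ∨
        (2 ≤ (colouredEdges c w true).ncard ∧ 2 ≤ (colouredEdges c w false).ncard)

/-- The number of NAC-colourings of a finite graph, divided by two. -/
noncomputable def nnac {V : Type*} [Finite V] (G : SimpleGraph V) : ℝ :=
  ({c : G.edgeSet → Bool | IsNACColouring G c}.ncard : ℝ) / 2

/-! ### Gluing copies of a graph along an edge -/

/-- The vertices of the graph obtained by gluing `k` copies of a graph on `V` along `ab`:
the two common vertices and, for each copy, one vertex for every element of `V` other than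
`a` and `b`. -/
abbrev GlueVertex {V : Type*} (a b : V) (k : ℕ) : Type _ :=
  Fin 2 ⊕ (Fin k × {x : V // x ≠ a ∧ x ≠ b})

/-- The inclusion of the vertices of the `i`-th copy. -/
def glueInclusion {V : Type*} [DecidableEq V] (a b : V) (k : ℕ) (i : Fin k) (x : V) :
    GlueVertex a b k :=
  if ha : x = a then Sum.inl 0
  else if hb : x = b then Sum.inl 1
  else Sum.inr (i, ⟨x, ha, hb⟩)

/-- The graph obtained by gluing `k` copies of `H` along the edge `ab`: the union of the images
of `H` under the inclusions of the `k` copies. -/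
def glueCopies {V : Type*} [DecidableEq V] (H : SimpleGraph V) (a b : V) (k : ℕ) :
    SimpleGraph (GlueVertex a b k) :=
  ⨆ i : Fin k, H.map (glueInclusion a b k i)

/-! ### The explicit base graph -/

/-- The graph with vertices `0, …, 17` and the 33 edges listed. -/
def baseGraph : SimpleGraph (Fin 18) :=
  SimpleGraph.fromRel fun u v => (u, v) ∈
    ([(0, 1), (0, 5), (0, 9), (1, 2), (1, 4), (1, 6), (1, 10), (1, 11), (1, 12), (1, 14), (1, 16),
      (2, 3), (2, 5), (3, 4), (3, 8), (3, 11), (4, 5), (5, 6), (5, 10), (5, 11), (5, 12), (5, 14),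
      (5, 16), (6, 7), (7, 8), (8, 9), (8, 13), (8, 15), (8, 17), (9, 10), (12, 13), (14, 15),
      (16, 17)] : List (Fin 18 × Fin 18))

/-! Rigidity. Pin two adjacent vertices `a`, `b` and record the squared lengths of the other edges.
If `|E| = 2|V| - 3` and no nonzero infinitesimal motion fixes `a` and `b`, the derivative of this
measurement map is bijective, so the map is a local homeomorphism. Its local injectivity excludes
non-trivial motions; its local surjectivity lets any one edge length vary alone, so deleting an edge
creates a motion (`isMinimallyRigid_of_isPinnedRigid`). The infinitesimal condition is the
nonvanishing of a rational polynomial in the coordinates, so one integral realisation of the base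
graph settles all generic ones (`IsPinnedRigid.of_generic`). The condition and the edge count both
survive gluing along an edge.

Counting. A surjective colouring is a NAC-colouring exactly when both colour classes are flats of
the cycle matroid, i.e. each class consists of the edges on which some vertex labelling is constant
(`isNACColouring_iff`). Admitting the two constant colourings and fixing the colour of one edge, the
number of colourings is `nnac G + 1`. Such colourings of the copies, with the shared edge red, glue
uniquely, which makes this number multiplicative (`goodCount_glueCopies`).

For the base graph, the labels of `1, 3, 5, 8, 9` decide everything: each further vertex, or pair of
adjacent vertices, meets the rest only in three of these. Up to renaming there are at most 120 label
patterns, so compatibility of a colouring becomes an intersection of 120-bit masks, and a pruned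
recursion counts 361216 = 2 · 180608 colourings. The growth rate follows from 2.13 ^ 16 < 180608. -/

/-! ### Minimal rigidity from pinned infinitesimal rigidity and the edge count. -/

section Rigidity

variable {V : Type*}

/-- `(G, p)` has no nonzero infinitesimal motion that fixes the vertices `a` and `b`. -/
def IsPinnedRigid (G : SimpleGraph V) (a b : V) (p : Realisation V 2) : Prop :=
  ∀ q : Realisation V 2, q a = 0 → q b = 0 →
    (∀ u v, G.Adj u v → inner ℝ (p u - p v) (q u - q v) = 0) → q = 0

lemma GenericRealisation.injective {d : ℕ} [NeZero d] {p : Realisation V d}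
    (hp : GenericRealisation p) : Function.Injective p := by
  intro u v h
  have := AlgebraicIndependent.injective hp (a₁ := (u, 0)) (a₂ := (v, 0)) (by simp [h])
  simpa using this

/-- The edges of `G` other than `ab`. -/
abbrev UnpinnedEdge (G : SimpleGraph V) (a b : V) : Type _ :=
  {e : Sym2 V // e ∈ G.edgeSet ∧ e ≠ s(a, b)}

/-- The squared lengths of the edges other than `ab`, and the positions of `a` and `b`. -/
noncomputable def pinnedMeasurement (G : SimpleGraph V) (a b : V) (q : Realisation V 2) :
    (UnpinnedEdge G a b → ℝ) × EuclideanSpace ℝ (Fin 2) × EuclideanSpace ℝ (Fin 2) :=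
  (fun e => ‖q e.1.out.1 - q e.1.out.2‖ ^ 2, q a, q b)

lemma norm_sub_eq_of_sym2_eq {E : Type*} [NormedAddCommGroup E] (p q : V → E) {u v x y : V}
    (h : s(u, v) = s(x, y)) (hx : ‖p x - p y‖ = ‖q x - q y‖) : ‖p u - p v‖ = ‖q u - q v‖ := by
  rcases Sym2.eq_iff.1 h with ⟨rfl, rfl⟩ | ⟨rfl, rfl⟩
  · exact hx
  · rw [norm_sub_rev, hx, norm_sub_rev]

lemma exists_unpinnedEdge {G : SimpleGraph V} {u v : V} (h : G.Adj u v) (a b : V)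
    (hne : s(u, v) ≠ s(a, b)) :
    ∃ e : UnpinnedEdge G a b, s(u, v) = s(e.1.out.1, e.1.out.2) :=
  ⟨⟨s(u, v), h, hne⟩, (Quot.out_eq (s(u, v))).symm⟩

/-- The derivative of `pinnedMeasurement`. -/
noncomputable def pinnedDeriv (G : SimpleGraph V) (a b : V) (p : Realisation V 2) :
    Realisation V 2 →L[ℝ]
      (UnpinnedEdge G a b → ℝ) × EuclideanSpace ℝ (Fin 2) × EuclideanSpace ℝ (Fin 2) :=
  (ContinuousLinearMap.pi fun e : UnpinnedEdge G a b =>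
    (2 : ℕ) • (innerSL ℝ (p e.1.out.1 - p e.1.out.2)).comp
      (ContinuousLinearMap.proj (R := ℝ) (φ := fun _ : V => EuclideanSpace ℝ (Fin 2)) e.1.out.1 -
        ContinuousLinearMap.proj (R := ℝ) (φ := fun _ : V => EuclideanSpace ℝ (Fin 2)) e.1.out.2)).prod
  ((ContinuousLinearMap.proj (R := ℝ) (φ := fun _ : V => EuclideanSpace ℝ (Fin 2)) a).prod
    (ContinuousLinearMap.proj (R := ℝ) (φ := fun _ : V => EuclideanSpace ℝ (Fin 2)) b))

lemma pinnedDeriv_injective {G : SimpleGraph V} {a b : V} {p : Realisation V 2}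
    (hp : IsPinnedRigid G a b p) : Function.Injective (pinnedDeriv G a b p) := by
  rw [injective_iff_map_eq_zero]
  intro q hq
  have h1 := fun e => congrFun (congrArg Prod.fst hq) e
  have ha : q a = 0 := congrArg (fun x => x.2.1) hq
  have hb : q b = 0 := congrArg (fun x => x.2.2) hq
  refine hp q ha hb fun u v huv => ?_
  -- The edge `ab` has no row in the derivative, but its condition is automatic because `q` vanishes
  -- at both ends.
  by_cases hne : s(u, v) = s(a, b)
  · rcases Sym2.eq_iff.1 hne with ⟨rfl, rfl⟩ | ⟨rfl, rfl⟩ <;> simp [ha, hb]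
  · obtain ⟨e, he⟩ := exists_unpinnedEdge huv a b hne
    have h2 := h1 e
    have h3 : inner ℝ (p e.1.out.1 - p e.1.out.2) (q e.1.out.1 - q e.1.out.2) = 0 := by
      simpa [pinnedDeriv, -map_sub, inner_sub_right] using h2
    rcases Sym2.eq_iff.1 he with ⟨rfl, rfl⟩ | ⟨rfl, rfl⟩
    · exact h3
    · rw [← neg_sub, ← neg_sub (q _), inner_neg_neg]
      exact h3

variable [Fintype V]

lemma hasStrictFDerivAt_pinnedMeasurement (G : SimpleGraph V) (a b : V) (p : Realisation V 2) :
    HasStrictFDerivAt (pinnedMeasurement G a b) (pinnedDeriv G a b p) p := by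
  classical
  have : Finite (UnpinnedEdge G a b) := inferInstance
  have : Fintype (UnpinnedEdge G a b) := Fintype.ofFinite _
  refine HasStrictFDerivAt.prodMk ?_ (HasStrictFDerivAt.prodMk ?_ ?_)
  · rw [hasStrictFDerivAt_pi]
    intro e
    have h := (hasStrictFDerivAt_norm_sq (p e.1.out.1 - p e.1.out.2)).comp p
      ((ContinuousLinearMap.proj (R := ℝ) (φ := fun _ : V => EuclideanSpace ℝ (Fin 2)) e.1.out.1 -
        ContinuousLinearMap.proj (R := ℝ) (φ := fun _ : V => EuclideanSpace ℝ (Fin 2))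
          e.1.out.2).hasStrictFDerivAt (x := p))
    simpa [Function.comp_def, smul_sub] using h
  · exact (ContinuousLinearMap.proj (R := ℝ) (φ := fun _ : V => EuclideanSpace ℝ (Fin 2)) a).hasStrictFDerivAt
  · exact (ContinuousLinearMap.proj (R := ℝ) (φ := fun _ : V => EuclideanSpace ℝ (Fin 2)) b).hasStrictFDerivAt

lemma natCard_unpinnedEdge {G : SimpleGraph V} {a b : V} (hab : G.Adj a b) :
    Nat.card (UnpinnedEdge G a b) + 1 = G.edgeSet.ncard := by
  classical
  have h : {e : Sym2 V | e ∈ G.edgeSet ∧ e ≠ s(a, b)} = G.edgeSet \ {s(a, b)} := by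
    ext; simp
  have := Set.ncard_sdiff_singleton_add_one (s := G.edgeSet) (a := s(a, b)) hab (Set.toFinite _)
  rw [← h] at this
  exact this

/-- The pinned measurement map is a local homeomorphism at an isostatic framework. -/
lemma exists_openPartialHomeomorph {G : SimpleGraph V} {a b : V} (hab : G.Adj a b)
    (hcard : G.edgeSet.ncard + 3 = 2 * Fintype.card V) {p : Realisation V 2}
    (hp : IsPinnedRigid G a b p) :
    ∃ Φ : OpenPartialHomeomorph (Realisation V 2)
        ((UnpinnedEdge G a b → ℝ) × EuclideanSpace ℝ (Fin 2) × EuclideanSpace ℝ (Fin 2)),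
      ⇑Φ = pinnedMeasurement G a b ∧ p ∈ Φ.source := by
  classical
  have : Fintype (UnpinnedEdge G a b) := Fintype.ofFinite _
  -- The dimensions agree, `2|V| = (|E| - 1) + 4`, so the injective derivative is an isomorphism.
  have hfin : Module.finrank ℝ (Realisation V 2) = Module.finrank ℝ
      ((UnpinnedEdge G a b → ℝ) × EuclideanSpace ℝ (Fin 2) × EuclideanSpace ℝ (Fin 2)) := by
    have := natCard_unpinnedEdge hab
    rw [Nat.card_eq_fintype_card] at this
    simp [Module.finrank_pi_fintype]
    omega
  let L := LinearEquiv.ofInjectiveOfFinrankEq (pinnedDeriv G a b p).toLinearMap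
    (pinnedDeriv_injective hp) hfin
  have hL : HasStrictFDerivAt (pinnedMeasurement G a b)
      (L.toContinuousLinearEquiv : _ →L[ℝ] _) p := by
    have hLe : (L.toContinuousLinearEquiv : _ →L[ℝ] _) = pinnedDeriv G a b p := by
      ext1 q; rfl
    rw [hLe]
    exact hasStrictFDerivAt_pinnedMeasurement G a b p
  exact ⟨hL.toOpenPartialHomeomorph, rfl, hL.mem_toOpenPartialHomeomorph_source⟩


/-- Multiplication by the complex number `c + s i` in the plane. -/
noncomputable def planeMul (c s : ℝ) (x : EuclideanSpace ℝ (Fin 2)) : EuclideanSpace ℝ (Fin 2) :=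
  !₂[c * x 0 - s * x 1, s * x 0 + c * x 1]

lemma planeMul_sub (c s : ℝ) (x y : EuclideanSpace ℝ (Fin 2)) :
    planeMul c s (x - y) = planeMul c s x - planeMul c s y := by
  ext i; fin_cases i <;> simp [planeMul] <;> ring

lemma norm_planeMul {c s : ℝ} (h : c ^ 2 + s ^ 2 = 1) (x : EuclideanSpace ℝ (Fin 2)) :
    ‖planeMul c s x‖ = ‖x‖ := by
  rw [EuclideanSpace.norm_eq, EuclideanSpace.norm_eq]
  congr 1
  simp only [planeMul, Fin.sum_univ_two, Real.norm_eq_abs, sq_abs]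
  simp
  linear_combination (x 0 ^ 2 + x 1 ^ 2) * h

lemma Continuous.planeMul {X : Type*} [TopologicalSpace X] {c s : X → ℝ}
    {x : X → EuclideanSpace ℝ (Fin 2)} (hc : Continuous c) (hs : Continuous s)
    (hx : Continuous x) : Continuous fun t => planeMul (c t) (s t) (x t) := by
  refine (PiLp.continuous_toLp 2 _).comp (continuous_pi fun i => ?_)
  fin_cases i
  · change Continuous fun t => c t * x t 0 - s t * x t 1
    fun_prop
  · change Continuous fun t => s t * x t 0 + c t * x t 1
    fun_prop

/-- There is a rotation, depending continuously on its data, that turns `x` into `d`. -/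
lemma planeMul_eq_of_norm_eq {d x : EuclideanSpace ℝ (Fin 2)} (hd : d ≠ 0) (h : ‖x‖ = ‖d‖) :
    ((x 0 * d 0 + x 1 * d 1) / ‖d‖ ^ 2) ^ 2 + ((x 0 * d 1 - x 1 * d 0) / ‖d‖ ^ 2) ^ 2 = 1 ∧
      planeMul ((x 0 * d 0 + x 1 * d 1) / ‖d‖ ^ 2) ((x 0 * d 1 - x 1 * d 0) / ‖d‖ ^ 2) x = d := by
  have hd0 : ‖d‖ ^ 2 ≠ 0 := by simpa using hd
  have h1 : ‖x‖ ^ 2 = x 0 ^ 2 + x 1 ^ 2 := by simp [EuclideanSpace.norm_sq_eq]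
  have h2 : ‖d‖ ^ 2 = d 0 ^ 2 + d 1 ^ 2 := by simp [EuclideanSpace.norm_sq_eq]
  rw [h] at h1
  generalize ‖d‖ ^ 2 = N at *
  constructor
  · field_simp
    linear_combination (-x 0 ^ 2 - x 1 ^ 2) * h2 - N * h1
  · ext i
    fin_cases i <;> simp [planeMul] <;> field_simp <;> linear_combination (-1) * d _ * h1

/-- At each time, compose the motion with the orientation-preserving isometry that returns `a` and
`b` to their initial positions. The normalised motion has constant pinned measurement, so by local
injectivity it cannot leave `p`. -/
lemma rigidFramework_of_isPinnedRigid {G : SimpleGraph V} {a b : V} (hab : G.Adj a b)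
    (hcard : G.edgeSet.ncard + 3 = 2 * Fintype.card V) {p : Realisation V 2}
    (hinj : p a ≠ p b) (hp : IsPinnedRigid G a b p) : RigidFramework G p := by
  obtain ⟨Φ, hΦ, hpΦ⟩ := exists_openPartialHomeomorph hab hcard hp
  rintro ⟨φ, ⟨hcont, h0, hmot⟩, hnon⟩
  refine hnon ?_
  set d := p b - p a with hd
  have hd0 : d ≠ 0 := sub_ne_zero.2 hinj.symm
  let I := Set.Ioo (-1 : ℝ) 1
  let x : I → EuclideanSpace ℝ (Fin 2) := fun t => φ t b - φ t a
  have hφc : ∀ v, Continuous fun t : I => φ t v := fun v =>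
    continuousOn_iff_continuous_domRestrict.1 (hcont v)
  have hxc : Continuous x := (hφc b).sub (hφc a)
  have hxn : ∀ t, ‖x t‖ = ‖d‖ := fun t => (hmot t t.2 b a hab.symm).symm
  -- As complex numbers, `c + s i = d / x = conj x * d / |d|²`, since `|x| = |d|`.
  let c : I → ℝ := fun t => (x t 0 * d 0 + x t 1 * d 1) / ‖d‖ ^ 2
  let s : I → ℝ := fun t => (x t 0 * d 1 - x t 1 * d 0) / ‖d‖ ^ 2
  have hc : Continuous c := by fun_prop
  have hs : Continuous s := by fun_prop
  have hcs : ∀ t, c t ^ 2 + s t ^ 2 = 1 := fun t => (planeMul_eq_of_norm_eq hd0 (hxn t)).1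
  have hcsx : ∀ t, planeMul (c t) (s t) (x t) = d := fun t =>
    (planeMul_eq_of_norm_eq hd0 (hxn t)).2
  let ψ : I → Realisation V 2 := fun t v => p a + planeMul (c t) (s t) (φ t v - φ t a)
  have hψn : ∀ t u v, ‖ψ t u - ψ t v‖ = ‖φ t u - φ t v‖ := fun t u v => by
    simp only [ψ, add_sub_add_left_eq_sub]
    rw [← planeMul_sub, norm_planeMul (hcs t), sub_sub_sub_cancel_right]
  have hψc : Continuous ψ := by
    exact continuous_pi fun v => continuous_const.add (hc.planeMul hs ((hφc v).sub (hφc a)))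
  have hΦψ : ∀ t, Φ (ψ t) = Φ p := fun t => by
    rw [hΦ]
    refine Prod.ext (funext fun e => ?_) (Prod.ext ?_ ?_)
    · have he : G.Adj e.1.out.1 e.1.out.2 := by
        have := e.2.1
        rwa [← Quot.out_eq e.1] at this
      simp only [pinnedMeasurement]
      rw [hψn, ← hmot t t.2 _ _ he]
    · simp [pinnedMeasurement, ψ, planeMul]
    · change p a + planeMul (c t) (s t) (x t) = p b
      rw [hcsx]; simp [d]
  have hz : (0 : ℝ) ∈ Set.Ioo (-1 : ℝ) 1 := by norm_num
  have hψ0 : ψ ⟨0, hz⟩ = p := by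
    have hx0 : x ⟨0, hz⟩ = d := by simp [x, h0, d]
    have hsum : d 0 ^ 2 + d 1 ^ 2 = ‖d‖ ^ 2 := by simp [EuclideanSpace.norm_sq_eq]
    have hc0 : c ⟨0, hz⟩ = 1 := by
      simp only [c, hx0]
      rw [← sq, ← sq, hsum]
      exact div_self (by simpa using hd0)
    have hs0 : s ⟨0, hz⟩ = 0 := by
      simp only [s, hx0]
      rw [mul_comm, sub_self, zero_div]
    funext v
    ext i
    fin_cases i <;> simp [ψ, hc0, hs0, h0, planeMul]
  have : PreconnectedSpace I := Subtype.preconnectedSpace isPreconnected_Ioo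
  -- Closed by continuity; open because `Φ` is injective near `p` and `Φ ∘ ψ` is constant.
  have hclopen : IsClopen {t | ψ t = p} := by
    refine ⟨isClosed_eq hψc continuous_const, isOpen_iff_mem_nhds.2 fun t ht => ?_⟩
    have hsrc : ∀ᶠ t' in nhds t, ψ t' ∈ Φ.source :=
      hψc.continuousAt.eventually_mem (by
        rw [show ψ t = p from ht]; exact Φ.open_source.mem_nhds hpΦ)
    filter_upwards [hsrc] with t' ht'
    exact Φ.injOn ht' hpΦ (hΦψ t')
  have huniv := hclopen.eq_univ ⟨_, hψ0⟩
  intro t ht u v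
  have h1 : ψ ⟨t, ht⟩ = p := by
    have : (⟨t, ht⟩ : I) ∈ {t | ψ t = p} := huniv ▸ Set.mem_univ _
    exact this
  rw [← hψn ⟨t, ht⟩, h1]

/-- Moving the pinned measurement along a segment gives a motion. -/
lemma exists_measurement_curve {G : SimpleGraph V} {a b : V} (hab : G.Adj a b)
    (hcard : G.edgeSet.ncard + 3 = 2 * Fintype.card V) {p : Realisation V 2}
    (hp : IsPinnedRigid G a b p)
    (w : (UnpinnedEdge G a b → ℝ) × EuclideanSpace ℝ (Fin 2) × EuclideanSpace ℝ (Fin 2)) :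
    ∃ (ε : ℝ) (φ : ℝ → Realisation V 2), 0 < ε ∧ ContinuousOn φ (Set.Ioo (-1) 1) ∧ φ 0 = p ∧
      ∀ t ∈ Set.Ioo (-1 : ℝ) 1,
        pinnedMeasurement G a b (φ t) = pinnedMeasurement G a b p + (t * ε) • w := by
  obtain ⟨Φ, hΦ, hpΦ⟩ := exists_openPartialHomeomorph hab hcard hp
  have hcont : Continuous fun r : ℝ => Φ p + r • w := by fun_prop
  have hnhds : (fun r : ℝ => Φ p + r • w) ⁻¹' Φ.target ∈ nhds 0 :=
    hcont.continuousAt.preimage_mem_nhds (Φ.open_target.mem_nhds (by simpa using Φ.map_source hpΦ))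
  obtain ⟨ε, hε, hball⟩ := Metric.mem_nhds_iff.1 hnhds
  have hmem : ∀ t ∈ Set.Ioo (-1 : ℝ) 1, Φ p + (t * ε) • w ∈ Φ.target := fun t ht => by
    refine hball (a := t * ε) ?_
    rw [mem_ball_zero_iff, Real.norm_eq_abs, abs_mul, abs_of_pos hε]
    nlinarith [abs_lt.2 ht]
  refine ⟨ε, fun t => Φ.symm (Φ p + (t * ε) • w), hε, ?_, by simp [hpΦ], fun t ht => ?_⟩
  · exact Φ.continuousOn_symm.comp (by fun_prop) hmem
  · rw [← hΦ, Φ.right_inv (hmem t ht)]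

/-- The coordinates of the pinned measurement can be moved independently near `p`; changing only the
length of the deleted edge keeps all other lengths and is visibly non-trivial. -/
lemma flexibleFramework_deleteEdges {G : SimpleGraph V} {a b : V} (hab : G.Adj a b)
    (hcard : G.edgeSet.ncard + 3 = 2 * Fintype.card V) {p : Realisation V 2}
    (hinj : p a ≠ p b) (hp : IsPinnedRigid G a b p) {e : Sym2 V} (he : e ∈ G.edgeSet) :
    FlexibleFramework (G.deleteEdges {e}) p := by
  classical
  have key : ∀ q : Realisation V 2, ∀ f : UnpinnedEdge G a b,
      (pinnedMeasurement G a b q).1 f = (pinnedMeasurement G a b p).1 f → ∀ u v, s(u, v) = f.1 →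
      ‖p u - p v‖ = ‖q u - q v‖ := by
    intro q f hf u v huv
    refine norm_sub_eq_of_sym2_eq p q (huv.trans (Quot.out_eq f.1).symm) ?_
    exact ((pow_left_inj₀ (norm_nonneg _) (norm_nonneg _) two_ne_zero).1 hf).symm
  -- The length of `ab` is no coordinate of the measurement; it is changed by pushing `b` away from
  -- `a` along their line.
  by_cases hne : e = s(a, b)
  · obtain ⟨ε, φ, hε, hφ, h0, hm⟩ := exists_measurement_curve hab hcard hp (0, 0, p b - p a)
    refine ⟨φ, ⟨fun v => (continuous_apply v).comp_continuousOn hφ, h0, ?_⟩, ?_⟩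
    · intro t ht u v huv
      rw [SimpleGraph.deleteEdges_adj] at huv
      refine key _ ⟨s(u, v), huv.1, by simpa [hne] using huv.2⟩ ?_ u v rfl
      simp [hm t ht]
    · intro h
      have ht : (1 / 2 : ℝ) ∈ Set.Ioo (-1 : ℝ) 1 := by norm_num
      have h1 := h _ ht b a
      have ha : φ (1 / 2) a = p a := by
        have := congrArg (fun x => x.2.1) (hm _ ht)
        simpa [pinnedMeasurement] using this
      have hb : φ (1 / 2) b = p b + (1 / 2 * ε) • (p b - p a) := by
        have := congrArg (fun x => x.2.2) (hm _ ht)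
        simpa [pinnedMeasurement] using this
      have h2 : φ (1 / 2) b - φ (1 / 2) a = (1 + 1 / 2 * ε) • (p b - p a) := by
        rw [ha, hb]; module
      rw [h2, norm_smul, Real.norm_eq_abs, abs_of_pos (by positivity)] at h1
      have : 0 < ‖p b - p a‖ := norm_pos_iff.2 (sub_ne_zero.2 hinj.symm)
      nlinarith
  · obtain ⟨ε, φ, hε, hφ, h0, hm⟩ := exists_measurement_curve hab hcard hp
      (Pi.single ⟨e, he, hne⟩ 1, 0, 0)
    refine ⟨φ, ⟨fun v => (continuous_apply v).comp_continuousOn hφ, h0, ?_⟩, ?_⟩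
    · intro t ht u v huv
      rw [SimpleGraph.deleteEdges_adj] at huv
      by_cases h : s(u, v) = s(a, b)
      · refine norm_sub_eq_of_sym2_eq _ _ h ?_
        have ha : φ t a = p a := by
          have := congrArg (fun x => x.2.1) (hm _ ht)
          simpa [pinnedMeasurement] using this
        have hb : φ t b = p b := by
          have := congrArg (fun x => x.2.2) (hm _ ht)
          simpa [pinnedMeasurement] using this
        rw [ha, hb]
      · refine key _ ⟨s(u, v), huv.1, h⟩ ?_ u v rfl
        have : (⟨s(u, v), huv.1, h⟩ : UnpinnedEdge G a b) ≠ ⟨e, he, hne⟩ := by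
          simpa using huv.2
        simp [hm t ht, Pi.single_eq_of_ne this]
    · intro h
      have ht : (1 / 2 : ℝ) ∈ Set.Ioo (-1 : ℝ) 1 := by norm_num
      have h1 := h _ ht e.out.1 e.out.2
      have h2 := congrFun (congrArg Prod.fst (hm _ ht)) ⟨e, he, hne⟩
      simp only [pinnedMeasurement, Prod.fst_add, Prod.smul_fst, Pi.add_apply, Pi.smul_apply,
        Pi.single_eq_same, h1, smul_eq_mul, mul_one] at h2
      linarith

lemma isMinimallyRigid_of_isPinnedRigid {G : SimpleGraph V} {a b : V} (hab : G.Adj a b)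
    (hcard : G.edgeSet.ncard + 3 = 2 * Fintype.card V)
    (hp : ∀ p : Realisation V 2, GenericRealisation p → IsPinnedRigid G a b p) :
    IsMinimallyRigid G :=
  ⟨fun p h => rigidFramework_of_isPinnedRigid hab hcard (h.injective.ne hab.ne) (hp p h),
    fun _ he p h => flexibleFramework_deleteEdges hab hcard (h.injective.ne hab.ne) (hp p h) he⟩

end Rigidity

/-! ### From one infinitesimally rigid realisation to all generic ones. -/

section Transfer

variable {V : Type*}

/-- The rigidity matrix of `(G, p)`, with additional rows that pin the vertices `a` and `b`. -/
def pinnedMatrix {A : Type*} [CommRing A] [DecidableEq V] (G : SimpleGraph V) [DecidableRel G.Adj]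
    (a b : V) (p : V × Fin 2 → A) : Matrix ((V × V) ⊕ (Fin 2 × Fin 2)) (V × Fin 2) A
  | Sum.inl e, x => if G.Adj e.1 e.2 then
      (p (e.1, x.2) - p (e.2, x.2)) * ((if x.1 = e.1 then 1 else 0) - if x.1 = e.2 then 1 else 0)
      else 0
  | Sum.inr s, x => if x = (![a, b] s.1, s.2) then 1 else 0

lemma pinnedMatrix_map {A B : Type*} [CommRing A] [CommRing B] [DecidableEq V] (f : A →+* B)
    (G : SimpleGraph V) [DecidableRel G.Adj] (a b : V) (p : V × Fin 2 → A) :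
    (pinnedMatrix G a b p).map f = pinnedMatrix G a b (f ∘ p) := by
  ext (e | s) x
  · simp only [pinnedMatrix, Matrix.map_apply]
    split_ifs <;> simp
  · simp only [pinnedMatrix, Matrix.map_apply]
    split_ifs <;> simp

variable [Fintype V] [DecidableEq V]

lemma pinnedMatrix_mulVec_eq_zero_iff {G : SimpleGraph V} [DecidableRel G.Adj] {a b : V}
    {p q : Realisation V 2} :
    (pinnedMatrix G a b fun x => p x.1 x.2).mulVec (fun x => q x.1 x.2) = 0 ↔
      q a = 0 ∧ q b = 0 ∧ ∀ u v, G.Adj u v → inner ℝ (p u - p v) (q u - q v) = 0 := by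
  have h1 : ∀ s : Fin 2 × Fin 2, (pinnedMatrix G a b fun x => p x.1 x.2).mulVec
      (fun x => q x.1 x.2) (Sum.inr s) = q (![a, b] s.1) s.2 := by
    intro s
    simp [Matrix.mulVec, dotProduct, pinnedMatrix]
  have h2 : ∀ u v, G.Adj u v → (pinnedMatrix G a b fun x => p x.1 x.2).mulVec
      (fun x => q x.1 x.2) (Sum.inl (u, v)) = inner ℝ (p u - p v) (q u - q v) := by
    intro u v huv
    simp [Matrix.mulVec, dotProduct, pinnedMatrix, huv, Fintype.sum_prod_type, mul_sub, sub_mul,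
      Finset.sum_sub_distrib, PiLp.inner_apply]
    ring
  constructor
  · intro h
    refine ⟨?_, ?_, fun u v huv => by rw [← h2 u v huv, h]; rfl⟩
    · ext i; simpa [h] using (h1 (0, i)).symm
    · ext i; simpa [h] using (h1 (1, i)).symm
  · rintro ⟨ha, hb, h⟩
    ext (⟨u, v⟩ | ⟨s, i⟩)
    · by_cases huv : G.Adj u v
      · rw [h2 u v huv, h u v huv]; rfl
      · simp [Matrix.mulVec, dotProduct, pinnedMatrix, huv]
    · rw [h1]
      fin_cases s <;> simp [ha, hb]

/-- Over the reals `Mᵀ M` has the same kernel as `M` and is square, so a single polynomial in the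
coordinates detects a trivial kernel. -/
lemma isPinnedRigid_iff_det_ne_zero {G : SimpleGraph V} [DecidableRel G.Adj] {a b : V}
    {p : Realisation V 2} :
    IsPinnedRigid G a b p ↔
      ((pinnedMatrix G a b fun x => p x.1 x.2).transpose *
        pinnedMatrix G a b fun x => p x.1 x.2).det ≠ 0 := by
  rw [Ne, ← Matrix.exists_mulVec_eq_zero_iff]
  simp only [← Matrix.conjTranspose_eq_transpose_of_trivial,
    Matrix.conjTranspose_mul_self_mulVec_eq_zero]
  constructor
  · rintro h ⟨x, hx, h0⟩
    have := (pinnedMatrix_mulVec_eq_zero_iff (G := G) (a := a) (b := b) (p := p)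
      (q := fun v => WithLp.toLp 2 fun i => x (v, i))).1 h0
    have hq := h _ this.1 this.2.1 this.2.2
    refine hx (funext fun y => ?_)
    exact congrArg (fun r : Realisation V 2 => r y.1 y.2) hq
  · intro h q ha hb hq
    by_contra hne
    refine h ⟨fun x => q x.1 x.2, fun h0 => hne ?_,
      pinnedMatrix_mulVec_eq_zero_iff.2 ⟨ha, hb, hq⟩⟩
    funext v
    ext i
    exact congrFun h0 (v, i)

/-- Pinned infinitesimal rigidity passes from any one realisation to all generic ones. -/
lemma IsPinnedRigid.of_generic {G : SimpleGraph V} {a b : V} {p₀ p : Realisation V 2}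
    (h : IsPinnedRigid G a b p₀) (hp : GenericRealisation p) : IsPinnedRigid G a b p := by
  classical
  let M := pinnedMatrix G a b (MvPolynomial.X (R := ℚ) : V × Fin 2 → _)
  have heval : ∀ r : Realisation V 2,
      MvPolynomial.aeval (fun x : V × Fin 2 => r x.1 x.2) (M.transpose * M).det =
      ((pinnedMatrix G a b fun x => r x.1 x.2).transpose *
        pinnedMatrix G a b fun x => r x.1 x.2).det := by
    intro r
    have hM : M.map (MvPolynomial.aeval (fun x : V × Fin 2 => r x.1 x.2)).toRingHom =
        pinnedMatrix G a b fun x => r x.1 x.2 := by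
      rw [pinnedMatrix_map]
      congr 1
      funext x
      simp
    rw [← hM, ← Matrix.transpose_map, ← Matrix.map_mul, ← RingHom.mapMatrix_apply,
      ← RingHom.map_det]
    rfl
  rw [isPinnedRigid_iff_det_ne_zero, ← heval] at h ⊢
  -- A rational polynomial vanishing at a generic point is zero, hence would vanish at `p₀` as well.
  intro h0
  apply h
  rw [algebraicIndependent_iff.1 hp _ h0, map_zero]

end Transfer

/-! ### Independence of the pinned pair. -/

section ChangeOfEdge

variable {V : Type*}

/-- In an infinitesimally rigid framework any two points in different positions may be pinned. -/
lemma IsPinnedRigid.change {G : SimpleGraph V} {a b c d : V} {p : Realisation V 2}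
    (h : IsPinnedRigid G a b p) (hab : G.Adj a b) (hpab : p a ≠ p b) (hcd : p c ≠ p d) :
    IsPinnedRigid G c d p := by
  intro q hc hd hq
  have hN : (p b 0 - p a 0) ^ 2 + (p b 1 - p a 1) ^ 2 ≠ 0 := by
    intro h0
    apply hpab
    ext i
    fin_cases i <;> simp <;> nlinarith [sq_nonneg (p b 0 - p a 0), sq_nonneg (p b 1 - p a 1)]
  have hperp : (p b 0 - p a 0) * (q b 0 - q a 0) + (p b 1 - p a 1) * (q b 1 - q a 1) = 0 := by
    have := hq b a hab.symm
    simp [PiLp.inner_apply] at this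
    linarith
  -- The velocity of `b` relative to `a` is perpendicular to `p b - p a`; `s` is the resulting
  -- angular velocity.
  obtain ⟨s, hs0, hs1⟩ : ∃ s : ℝ, q b 0 - q a 0 = -s * (p b 1 - p a 1) ∧
      q b 1 - q a 1 = s * (p b 0 - p a 0) := by
    refine ⟨((p b 0 - p a 0) * (q b 1 - q a 1) - (p b 1 - p a 1) * (q b 0 - q a 0)) /
      ((p b 0 - p a 0) ^ 2 + (p b 1 - p a 1) ^ 2), ?_, ?_⟩
    · field_simp
      linear_combination (p b 0 - p a 0) * hperp
    · field_simp
      linear_combination (p b 1 - p a 1) * hperp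
  -- Subtracting the translation by `q a` and the infinitesimal rotation about `p a` leaves a motion
  -- that fixes `a` and `b`, hence zero.
  have hr := h (fun v => !₂[q v 0 - q a 0 + s * (p v 1 - p a 1),
    q v 1 - q a 1 - s * (p v 0 - p a 0)]) ?_ ?_ ?_
  · have e0 : ∀ v, q v 0 - q a 0 + s * (p v 1 - p a 1) = 0 := fun v => by
      simpa using congrArg (fun r : Realisation V 2 => r v 0) hr
    have e1 : ∀ v, q v 1 - q a 1 - s * (p v 0 - p a 0) = 0 := fun v => by
      simpa using congrArg (fun r : Realisation V 2 => r v 1) hr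
    have c0 := e0 c
    have c1 := e1 c
    have d0 := e0 d
    have d1 := e1 d
    simp only [hc, hd, PiLp.zero_apply] at c0 c1 d0 d1
    -- A nonzero infinitesimal rotation has a single fixed point, whereas `q` vanishes at the
    -- distinct points `p c` and `p d`.
    have hs : s = 0 := by
      by_contra hs
      apply hcd
      ext i
      fin_cases i
      · exact mul_left_cancel₀ hs (by simp only [Fin.zero_eta]; linarith)
      · exact mul_left_cancel₀ hs (by simp only [Fin.mk_one]; linarith)
    subst hs
    funext v
    ext i
    fin_cases i
    · have := e0 v
      simp only [Fin.zero_eta, Pi.zero_apply, PiLp.zero_apply]; linarith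
    · have := e1 v
      simp only [Fin.mk_one, Pi.zero_apply, PiLp.zero_apply]; linarith
  · ext i; fin_cases i <;> simp
  · ext i
    fin_cases i
    · simp only [Fin.zero_eta]
      simp
      linarith
    · simp
      linarith
  · intro u v huv
    have := hq u v huv
    simp [PiLp.inner_apply] at this ⊢
    linarith

end ChangeOfEdge

/-! ### Minimal rigidity of the base graph. -/

section BaseRigid

instance : DecidableRel baseGraph.Adj := fun u v => by
  unfold baseGraph; infer_instance

/-- A realisation of the base graph with integral coordinates. -/
noncomputable def baseRealisation : Realisation (Fin 18) 2 := fun v =>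
  !₂[(![1, 0, 1, 1, 0, 3, 2, 7, -1, 5, 0, 2, 1, 1, 1, 2, -1, 3] : Fin 18 → ℝ) v,
    (![1, 0, 0, 2, 1, 1, 0, 1, 1, -3, -1, 3, 3, 5, -2, 2, 2, 5] : Fin 18 → ℝ) v]

lemma baseRealisation_isPinnedRigid : IsPinnedRigid baseGraph 1 2 baseRealisation := by
  intro q h1 h2 hq
  have key : ∀ u v, baseGraph.Adj u v →
      (baseRealisation u 0 - baseRealisation v 0) * (q u 0 - q v 0) +
        (baseRealisation u 1 - baseRealisation v 1) * (q u 1 - q v 1) = 0 := fun u v huv => by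
    have := hq u v huv
    simp only [PiLp.inner_apply, PiLp.sub_apply, RCLike.inner_apply, conj_trivial,
      Fin.sum_univ_two] at this
    linarith
  have z10 : q 1 0 = 0 := by simp [h1]
  have z11 : q 1 1 = 0 := by simp [h1]
  have z20 : q 2 0 = 0 := by simp [h2]
  have z21 : q 2 1 = 0 := by simp [h2]
  -- The vertices `1, 3, 5` and `2, 4, 11` span a complete bipartite graph; with `1` and `2` pinned,
  -- its eight other edges determine the four remaining velocities.
  have e1_4 : (1) * q 4 1 = 0 := by
    have := key 1 4 (by decide)
    simp [-mul_eq_zero, baseRealisation, z10, z11] at this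
    linarith
  have e1_11 : (2) * q 11 0 + (3) * q 11 1 = 0 := by
    have := key 1 11 (by decide)
    simp [-mul_eq_zero, baseRealisation, z10, z11] at this
    linarith
  have e2_3 : (2) * q 3 1 = 0 := by
    have := key 2 3 (by decide)
    simp [-mul_eq_zero, baseRealisation, z20, z21] at this
    linarith
  have e2_5 : (2) * q 5 0 + (1) * q 5 1 = 0 := by
    have := key 2 5 (by decide)
    simp [-mul_eq_zero, baseRealisation, z20, z21] at this
    linarith
  have e3_4 : (1) * q 3 0 + (-1) * q 4 0 + (1) * q 3 1 + (-1) * q 4 1 = 0 := by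
    have := key 3 4 (by decide)
    simp [-mul_eq_zero, baseRealisation] at this
    linarith
  have e3_11 : (-1) * q 3 0 + (1) * q 11 0 + (-1) * q 3 1 + (1) * q 11 1 = 0 := by
    have := key 3 11 (by decide)
    simp [-mul_eq_zero, baseRealisation] at this
    linarith
  have e4_5 : (-3) * q 4 0 + (3) * q 5 0 = 0 := by
    have := key 4 5 (by decide)
    simp [-mul_eq_zero, baseRealisation] at this
    linarith
  have e5_11 : (1) * q 5 0 + (-1) * q 11 0 + (-2) * q 5 1 + (2) * q 11 1 = 0 := by
    have := key 5 11 (by decide)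
    simp [-mul_eq_zero, baseRealisation] at this
    linarith
  have z30 : q 3 0 = 0 := by linarith
  have z31 : q 3 1 = 0 := by linarith
  have z40 : q 4 0 = 0 := by linarith
  have z41 : q 4 1 = 0 := by linarith
  have z50 : q 5 0 = 0 := by linarith
  have z51 : q 5 1 = 0 := by linarith
  have z110 : q 11 0 = 0 := by linarith
  have z111 : q 11 1 = 0 := by linarith
  -- Each later vertex is joined to two vertices already known to be at rest, in two independent
  -- directions.
  have e0_1 : (1) * q 0 0 + (1) * q 0 1 = 0 := by
    have := key 0 1 (by decide)
    simp [-mul_eq_zero, baseRealisation, z10, z11] at this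
    linarith
  have e0_5 : (-2) * q 0 0 = 0 := by
    have := key 0 5 (by decide)
    simp [-mul_eq_zero, baseRealisation, z50, z51] at this
    linarith
  have z00 : q 0 0 = 0 := by linarith
  have z01 : q 0 1 = 0 := by linarith
  have e1_10 : (-1) * q 10 1 = 0 := by
    have := key 1 10 (by decide)
    simp [-mul_eq_zero, baseRealisation, z10, z11] at this
    linarith
  have e5_10 : (-3) * q 10 0 + (-2) * q 10 1 = 0 := by
    have := key 5 10 (by decide)
    simp [-mul_eq_zero, baseRealisation, z50, z51] at this
    linarith
  have z100 : q 10 0 = 0 := by linarith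
  have z101 : q 10 1 = 0 := by linarith
  have e0_9 : (4) * q 9 0 + (-4) * q 9 1 = 0 := by
    have := key 0 9 (by decide)
    simp [-mul_eq_zero, baseRealisation, z00, z01] at this
    linarith
  have e9_10 : (5) * q 9 0 + (-2) * q 9 1 = 0 := by
    have := key 9 10 (by decide)
    simp [-mul_eq_zero, baseRealisation, z100, z101] at this
    linarith
  have z90 : q 9 0 = 0 := by linarith
  have z91 : q 9 1 = 0 := by linarith
  have e3_8 : (-2) * q 8 0 + (-1) * q 8 1 = 0 := by
    have := key 3 8 (by decide)
    simp [-mul_eq_zero, baseRealisation, z30, z31] at this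
    linarith
  have e8_9 : (-6) * q 8 0 + (4) * q 8 1 = 0 := by
    have := key 8 9 (by decide)
    simp [-mul_eq_zero, baseRealisation, z90, z91] at this
    linarith
  have z80 : q 8 0 = 0 := by linarith
  have z81 : q 8 1 = 0 := by linarith
  have e1_6 : (2) * q 6 0 = 0 := by
    have := key 1 6 (by decide)
    simp [-mul_eq_zero, baseRealisation, z10, z11] at this
    linarith
  have e5_6 : (-1) * q 6 0 + (-1) * q 6 1 = 0 := by
    have := key 5 6 (by decide)
    simp [-mul_eq_zero, baseRealisation, z50, z51] at this
    linarith
  have z60 : q 6 0 = 0 := by linarith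
  have z61 : q 6 1 = 0 := by linarith
  have e1_12 : (1) * q 12 0 + (3) * q 12 1 = 0 := by
    have := key 1 12 (by decide)
    simp [-mul_eq_zero, baseRealisation, z10, z11] at this
    linarith
  have e5_12 : (-2) * q 12 0 + (2) * q 12 1 = 0 := by
    have := key 5 12 (by decide)
    simp [-mul_eq_zero, baseRealisation, z50, z51] at this
    linarith
  have z120 : q 12 0 = 0 := by linarith
  have z121 : q 12 1 = 0 := by linarith
  have e1_14 : (1) * q 14 0 + (-2) * q 14 1 = 0 := by
    have := key 1 14 (by decide)
    simp [-mul_eq_zero, baseRealisation, z10, z11] at this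
    linarith
  have e5_14 : (-2) * q 14 0 + (-3) * q 14 1 = 0 := by
    have := key 5 14 (by decide)
    simp [-mul_eq_zero, baseRealisation, z50, z51] at this
    linarith
  have z140 : q 14 0 = 0 := by linarith
  have z141 : q 14 1 = 0 := by linarith
  have e1_16 : (-1) * q 16 0 + (2) * q 16 1 = 0 := by
    have := key 1 16 (by decide)
    simp [-mul_eq_zero, baseRealisation, z10, z11] at this
    linarith
  have e5_16 : (-4) * q 16 0 + (1) * q 16 1 = 0 := by
    have := key 5 16 (by decide)
    simp [-mul_eq_zero, baseRealisation, z50, z51] at this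
    linarith
  have z160 : q 16 0 = 0 := by linarith
  have z161 : q 16 1 = 0 := by linarith
  have e6_7 : (5) * q 7 0 + (1) * q 7 1 = 0 := by
    have := key 6 7 (by decide)
    simp [-mul_eq_zero, baseRealisation, z60, z61] at this
    linarith
  have e7_8 : (8) * q 7 0 = 0 := by
    have := key 7 8 (by decide)
    simp [-mul_eq_zero, baseRealisation, z80, z81] at this
    linarith
  have z70 : q 7 0 = 0 := by linarith
  have z71 : q 7 1 = 0 := by linarith
  have e12_13 : (2) * q 13 1 = 0 := by
    have := key 12 13 (by decide)
    simp [-mul_eq_zero, baseRealisation, z120, z121] at this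
    linarith
  have e8_13 : (2) * q 13 0 + (4) * q 13 1 = 0 := by
    have := key 8 13 (by decide)
    simp [-mul_eq_zero, baseRealisation, z80, z81] at this
    linarith
  have z130 : q 13 0 = 0 := by linarith
  have z131 : q 13 1 = 0 := by linarith
  have e14_15 : (1) * q 15 0 + (4) * q 15 1 = 0 := by
    have := key 14 15 (by decide)
    simp [-mul_eq_zero, baseRealisation, z140, z141] at this
    linarith
  have e8_15 : (3) * q 15 0 + (1) * q 15 1 = 0 := by
    have := key 8 15 (by decide)
    simp [-mul_eq_zero, baseRealisation, z80, z81] at this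
    linarith
  have z150 : q 15 0 = 0 := by linarith
  have z151 : q 15 1 = 0 := by linarith
  have e16_17 : (4) * q 17 0 + (3) * q 17 1 = 0 := by
    have := key 16 17 (by decide)
    simp [-mul_eq_zero, baseRealisation, z160, z161] at this
    linarith
  have e8_17 : (4) * q 17 0 + (4) * q 17 1 = 0 := by
    have := key 8 17 (by decide)
    simp [-mul_eq_zero, baseRealisation, z80, z81] at this
    linarith
  have z170 : q 17 0 = 0 := by linarith
  have z171 : q 17 1 = 0 := by linarith
  funext v
  ext i
  fin_cases v <;> fin_cases i <;> assumption

/-- Every generic realisation of the base graph is infinitesimally rigid. -/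
lemma isPinnedRigid_baseGraph {a b : Fin 18} (hab : baseGraph.Adj a b)
    {p : Realisation (Fin 18) 2} (hp : GenericRealisation p) : IsPinnedRigid baseGraph a b p :=
  (baseRealisation_isPinnedRigid.of_generic hp).change (by decide)
    (hp.injective.ne (by decide)) (hp.injective.ne hab.ne)

lemma ncard_edgeSet_baseGraph : baseGraph.edgeSet.ncard = 33 := by
  rw [← SimpleGraph.coe_edgeFinset, Set.ncard_coe_finset]
  decide +kernel

lemma isMinimallyRigid_baseGraph : IsMinimallyRigid baseGraph :=
  isMinimallyRigid_of_isPinnedRigid (a := 1) (b := 2) (by decide)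
    (by rw [ncard_edgeSet_baseGraph]; simp) fun _ hp => isPinnedRigid_baseGraph (by decide) hp

end BaseRigid

/-! ### NAC-colourings as colourings by two flats. -/

section FlatColourings

variable {V : Type*} {G : SimpleGraph V}

/-- The edges of colour `b` are those joining vertices with the same label, for some labelling of
the vertices. -/
def IsFlat (c : G.edgeSet → Bool) (b : Bool) : Prop :=
  ∃ f : V → ℕ, ∀ (u v : V) (h : G.Adj u v), c ⟨s(u, v), h⟩ = b ↔ f u = f v

/-- Both colour classes are flats of the cycle matroid. -/
def IsGoodColouring (c : G.edgeSet → Bool) : Prop := ∀ b, IsFlat c b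

lemma SimpleGraph.Reachable.map_eq {α : Type*} {f : V → α} (hf : ∀ u v, G.Adj u v → f u = f v)
    {u v : V} (h : G.Reachable u v) : f u = f v := by
  obtain ⟨w⟩ := h
  induction w with
  | nil => rfl
  | cons h _ ih => exact (hf _ _ h).trans ih

/-- The subgraph of edges of colour `b`. -/
def colourGraph (c : G.edgeSet → Bool) (b : Bool) : SimpleGraph V :=
  SimpleGraph.fromEdgeSet {e | ∃ h : e ∈ G.edgeSet, c ⟨e, h⟩ = b}

lemma colourGraph_adj {c : G.edgeSet → Bool} {b : Bool} {u v : V} :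
    (colourGraph c b).Adj u v ↔ ∃ h : G.Adj u v, c ⟨s(u, v), h⟩ = b := by
  rw [colourGraph, SimpleGraph.fromEdgeSet_adj]
  exact ⟨fun h => h.1, fun ⟨h, hc⟩ => ⟨⟨h, hc⟩, h.ne⟩⟩

/-- A path of colour `b` between the ends of an edge of the other colour would close up to a cycle
with exactly one edge of that colour. -/
lemma IsNACColouring.not_reachable {c : G.edgeSet → Bool} (hc : IsNACColouring G c) {b : Bool}
    {u v : V} (h : G.Adj u v) (hb : c ⟨s(u, v), h⟩ ≠ b) :
    ¬ (colourGraph c b).Reachable u v := by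
  intro hr
  let K := colourGraph c b ⊔ SimpleGraph.fromEdgeSet {s(u, v)}
  have hKe : ∀ e ∈ K.edgeSet, e = s(u, v) ∨ ∃ h : e ∈ G.edgeSet, c ⟨e, h⟩ = b := by
    intro e
    induction e with | _ x y
    intro he
    rcases he with he | he
    · exact Or.inr (colourGraph_adj.1 he)
    · exact Or.inl he.1
  have hKG : K ≤ G := by
    intro x y hxy
    rcases hKe s(x, y) hxy with h1 | ⟨h1, -⟩
    · exact (G.mem_edgeSet).1 (h1 ▸ h)
    · exact h1
  have hadj : K.Adj u v := Or.inr ⟨rfl, h.ne⟩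
  have hle : colourGraph c b ≤ K \ SimpleGraph.fromEdgeSet {s(u, v)} := by
    intro x y hxy
    refine ⟨Or.inl hxy, fun h' => ?_⟩
    obtain ⟨h1, h2⟩ := colourGraph_adj.1 hxy
    have he : s(x, y) = s(u, v) := h'.1
    apply hb
    rw [← h2]
    congr 2
    exact he.symm
  obtain ⟨x, p, hp, hmem⟩ := SimpleGraph.adj_and_reachable_delete_edges_iff_exists_cycle.1
    ⟨hadj, hr.mono hle⟩
  have hedges := fun e (he : e ∈ p.edges) => hKe e (p.edges_subset_edgeSet he)
  rcases hc.2 x (p.mapLe hKG) (hp.mapLe hKG) with ⟨b', hb'⟩ | ⟨h1, h2⟩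
  -- A monochromatic cycle through `uv` in `K` could use no edge but `uv`, which is too short.
  · simp only [SimpleGraph.Walk.edges_mapLe_eq_edges] at hb'
    have huv := hb' ⟨s(u, v), h⟩ hmem
    have hall : ∀ e ∈ p.edges, e = s(u, v) := by
      intro e he
      rcases hedges e he with h1 | ⟨h1, h2⟩
      · exact h1
      · exact absurd (huv.trans ((hb' ⟨e, h1⟩ he).symm.trans h2)) hb
    have hlen := hp.three_le_length
    rw [← SimpleGraph.Walk.length_edges, List.eq_replicate_of_mem hall] at hlen
    have hnd := hp.edges_nodup
    rw [List.eq_replicate_of_mem hall, List.nodup_replicate] at hnd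
    simp only [List.length_replicate] at hlen
    omega
  · have hsub : colouredEdges c (p.mapLe hKG) (!b) ⊆ {⟨s(u, v), h⟩} := by
      rintro ⟨e, heG⟩ ⟨he, hce⟩
      rw [SimpleGraph.Walk.edges_mapLe_eq_edges] at he
      rcases hedges e he with h1 | ⟨h1, h2⟩
      · exact Subtype.ext h1
      · rw [h2] at hce
        simp at hce
    have := Set.ncard_le_ncard hsub (Set.finite_singleton _)
    rw [Set.ncard_singleton] at this
    cases b <;> simp only [Bool.not_true, Bool.not_false] at this <;> omega

/-- Label each vertex by its component in the subgraph of colour `b`. -/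
lemma IsNACColouring.isGoodColouring [Finite V] {c : G.edgeSet → Bool}
    (hc : IsNACColouring G c) : IsGoodColouring c := by
  intro b
  have : Finite (colourGraph c b).ConnectedComponent := Quot.finite _
  obtain ⟨F, hF⟩ := exists_injective_nat (colourGraph c b).ConnectedComponent
  refine ⟨fun v => F ((colourGraph c b).connectedComponentMk v), fun u v h => ?_⟩
  rw [hF.eq_iff, SimpleGraph.ConnectedComponent.eq]
  constructor
  · intro hb
    exact (colourGraph_adj.2 ⟨h, hb⟩).reachable
  · intro hr
    by_contra hb
    exact hc.not_reachable h hb hr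

/-- If `e` were the only edge of its colour on the cycle, a labelling for the other colour would be
constant along the rest of the cycle, forcing the other colour on `e` too. -/
lemma IsGoodColouring.two_le_ncard {c : G.edgeSet → Bool} (hc : IsGoodColouring c) {v : V}
    {w : G.Walk v v} (hw : w.IsCycle) {b : Bool} {e : G.edgeSet} (he : (e : Sym2 V) ∈ w.edges)
    (hb : c e = b) : 2 ≤ (colouredEdges c w b).ncard := by
  have hfin : (colouredEdges c w b).Finite := by
    refine Set.Finite.of_finite_image ((List.finite_toSet w.edges).subset ?_)
      Subtype.val_injective.injOn
    rintro _ ⟨e, h, rfl⟩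
    exact h.1
  by_contra hlt
  have hone : ∀ e' ∈ colouredEdges c w b, e' = e := fun e' he' => by
    by_contra hne
    exact hlt ((Set.one_lt_ncard hfin).2 ⟨e', he', e, ⟨he, hb⟩, hne⟩)
  obtain ⟨⟨x, y⟩, hxy⟩ := e
  obtain ⟨g, hg⟩ := hc (!b)
  let K := SimpleGraph.fromEdgeSet {e | e ∈ w.edges}
  have hwK : ∀ e ∈ w.edges, e ∈ K.edgeSet := by
    intro e he
    rw [SimpleGraph.edgeSet_fromEdgeSet]
    exact ⟨he, G.not_isDiag_of_mem_edgeSet (w.edges_subset_edgeSet he)⟩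
  have hr := (SimpleGraph.adj_and_reachable_delete_edges_iff_exists_cycle (v := x) (w := y)).2
    ⟨v, w.transfer K hwK, hw.transfer hwK, by rw [SimpleGraph.Walk.edges_transfer]; exact he⟩
  have hxy' : c ⟨s(x, y), hxy⟩ = !b := by
    refine (hg x y hxy).2 (hr.2.map_eq fun u u' huu' => ?_)
    have hmem : s(u, u') ∈ w.edges := huu'.1.1
    refine (hg u u' (w.edges_subset_edgeSet hmem)).1 ?_
    by_contra hne
    have := hone ⟨s(u, u'), w.edges_subset_edgeSet hmem⟩ ⟨hmem, by simpa using hne⟩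
    exact huu'.2 ⟨congrArg Subtype.val this, huu'.1.2⟩
  have : b = !b := hb.symm.trans hxy'
  simp at this

/-- A colouring is a NAC-colouring if and only if it is surjective and both of its colour classes
are flats. -/
lemma isNACColouring_iff [Finite V] {c : G.edgeSet → Bool} :
    IsNACColouring G c ↔ Function.Surjective c ∧ IsGoodColouring c := by
  refine ⟨fun h => ⟨h.1, h.isGoodColouring⟩, fun ⟨hs, hc⟩ => ⟨hs, fun v w hw => ?_⟩⟩
  by_cases h1 : ∃ e : G.edgeSet, (e : Sym2 V) ∈ w.edges ∧ c e = true
  · by_cases h2 : ∃ e : G.edgeSet, (e : Sym2 V) ∈ w.edges ∧ c e = false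
    · obtain ⟨e, he, hb⟩ := h1
      obtain ⟨e', he', hb'⟩ := h2
      exact Or.inr ⟨hc.two_le_ncard hw he hb, hc.two_le_ncard hw he' hb'⟩
    · push Not at h2
      exact Or.inl ⟨true, fun e he => by simpa using h2 e he⟩
  · push Not at h1
    exact Or.inl ⟨false, fun e he => by simpa using h1 e he⟩

lemma isGoodColouring_const [Finite V] (b : Bool) :
    IsGoodColouring (fun _ : G.edgeSet => b) := by
  intro b'
  by_cases h : b = b'
  · exact ⟨fun _ => 0, fun u v _ => by simp [h]⟩
  · obtain ⟨F, hF⟩ := exists_injective_nat V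
    exact ⟨F, fun u v huv => by simp [h, hF.eq_iff, huv.ne]⟩

lemma IsGoodColouring.not {c : G.edgeSet → Bool} (hc : IsGoodColouring c) :
    IsGoodColouring fun e => !c e := by
  intro b
  obtain ⟨f, hf⟩ := hc (!b)
  exact ⟨f, fun u v h => Bool.not_eq_eq_eq_not.trans (hf u v h)⟩

lemma IsGoodColouring.comp_hom {W : Type*} {K : SimpleGraph W} (φ : K →g G)
    {c : G.edgeSet → Bool} (hc : IsGoodColouring c) :
    IsGoodColouring (c ∘ φ.mapEdgeSet) := by
  intro b
  obtain ⟨f, hf⟩ := hc b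
  exact ⟨f ∘ φ, fun u v h => hf _ _ (φ.map_adj h)⟩

/-- The extra colourings are the two constant ones, which differ because there is an edge. -/
lemma ncard_isGoodColouring [Finite V] (e : G.edgeSet) :
    {c : G.edgeSet → Bool | IsGoodColouring c}.ncard =
      {c : G.edgeSet → Bool | IsNACColouring G c}.ncard + 2 := by
  have : {c : G.edgeSet → Bool | IsGoodColouring c} =
      {c | IsNACColouring G c} ∪ {fun _ => true, fun _ => false} := by
    ext c
    simp only [Set.mem_ofPred_eq, Set.mem_union, Set.mem_insert_iff, Set.mem_singleton_iff,
      isNACColouring_iff]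
    constructor
    · intro hc
      by_cases hs : Function.Surjective c
      · exact Or.inl ⟨hs, hc⟩
      · simp only [Function.Surjective, Bool.forall_bool, not_and_or, not_exists,
          Bool.not_eq_false, Bool.not_eq_true] at hs
        exact Or.inr (hs.imp funext funext)
    · rintro (h | rfl | rfl)
      · exact h.2
      · exact isGoodColouring_const _
      · exact isGoodColouring_const _
  rw [this, Set.ncard_union_eq, Set.ncard_pair]
  · intro h
    simpa using congrFun h e
  · rw [Set.disjoint_right]
    rintro c (rfl | rfl) h
    · obtain ⟨e', he'⟩ := h.1 false
      simp at he'
    · obtain ⟨e', he'⟩ := h.1 true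
      simp at he'

/-- The number of colourings whose colour classes are flats and in which the edge `e` is red. -/
noncomputable def goodCount (G : SimpleGraph V) (e : G.edgeSet) : ℕ :=
  {c : G.edgeSet → Bool | IsGoodColouring c ∧ c e = true}.ncard

lemma ncard_isGoodColouring_eq_two_mul [Finite V] (e : G.edgeSet) :
    {c : G.edgeSet → Bool | IsGoodColouring c}.ncard = 2 * goodCount G e := by
  have h1 : {c : G.edgeSet → Bool | IsGoodColouring c} =
      {c | IsGoodColouring c ∧ c e = true} ∪ {c | IsGoodColouring c ∧ c e = false} := by
    ext c
    simp only [Set.mem_ofPred_eq, Set.mem_union, ← and_or_left, Bool.eq_false_or_eq_true, and_true]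
  have h2 : {c : G.edgeSet → Bool | IsGoodColouring c ∧ c e = false} =
      (fun c e => !c e) '' {c : G.edgeSet → Bool | IsGoodColouring c ∧ c e = true} := by
    ext c
    constructor
    · rintro ⟨hc, he⟩
      exact ⟨fun e => !c e, ⟨hc.not, by simp [he]⟩, by simp⟩
    · rintro ⟨c, ⟨hc, he⟩, rfl⟩
      exact ⟨hc.not, by simp [he]⟩
  have hinj : Function.Injective fun (c : G.edgeSet → Bool) e => !c e := fun c d h =>
    funext fun e => by simpa using congrFun h e
  rw [h1, Set.ncard_union_eq, h2, Set.ncard_image_of_injective _ hinj, goodCount, two_mul]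
  rw [Set.disjoint_left]
  rintro c ⟨-, hc⟩ ⟨-, hc'⟩
  simp [hc] at hc'

/-- Swapping colours halves the count: the two constant colourings contribute the 1. In this form
the count is multiplicative under gluing. -/
lemma nnac_add_one [Finite V] (e : G.edgeSet) : nnac G + 1 = goodCount G e := by
  have h1 := ncard_isGoodColouring e
  rw [ncard_isGoodColouring_eq_two_mul e] at h1
  have h2 : (2 : ℝ) * goodCount G e = {c : G.edgeSet → Bool | IsNACColouring G c}.ncard + 2 := by
    exact_mod_cast h1
  rw [nnac]
  linarith

end FlatColourings

/-! ### Gluing copies along an edge. -/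

section Glue

variable {V : Type*} [DecidableEq V] {H : SimpleGraph V} {a b : V} {k : ℕ}

lemma glueInclusion_left (i : Fin k) : glueInclusion a b k i a = Sum.inl 0 := by
  simp [glueInclusion]

lemma glueInclusion_right (hab : a ≠ b) (i : Fin k) : glueInclusion a b k i b = Sum.inl 1 := by
  simp [glueInclusion, hab.symm]

lemma glueInclusion_of_ne (i : Fin k) {x : V} (h : x ≠ a ∧ x ≠ b) :
    glueInclusion a b k i x = Sum.inr (i, ⟨x, h⟩) := by
  simp [glueInclusion, h.1, h.2]

lemma glueInclusion_injective (i : Fin k) : Function.Injective (glueInclusion a b k i) := by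
  intro x y h
  unfold glueInclusion at h
  split_ifs at h <;> simp_all

lemma exists_glueInclusion_eq (hab : a ≠ b) (i₀ : Fin k) (x : GlueVertex a b k) :
    ∃ i v, glueInclusion a b k i v = x := by
  rcases x with s | ⟨i, v, hv⟩
  · fin_cases s
    · exact ⟨i₀, a, glueInclusion_left i₀⟩
    · exact ⟨i₀, b, glueInclusion_right hab i₀⟩
  · exact ⟨i, v, glueInclusion_of_ne i hv⟩

lemma glueCopies_adj {x y : GlueVertex a b k} :
    (glueCopies H a b k).Adj x y ↔ ∃ i u v, H.Adj u v ∧ glueInclusion a b k i u = x ∧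
      glueInclusion a b k i v = y := by
  simp only [glueCopies, SimpleGraph.iSup_adj]
  exact exists_congr fun i =>
    SimpleGraph.map_adj ⟨glueInclusion a b k i, glueInclusion_injective i⟩ H x y

/-- The inclusion of the `i`-th copy. -/
def glueHom (H : SimpleGraph V) (a b : V) (k : ℕ) (i : Fin k) : H →g glueCopies H a b k where
  toFun := glueInclusion a b k i
  map_rel' h := glueCopies_adj.2 ⟨i, _, _, h, rfl, rfl⟩

lemma exists_edge_eq (e : (glueCopies H a b k).edgeSet) :
    ∃ i, ∃ f : H.edgeSet, (glueHom H a b k i).mapEdgeSet f = e := by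
  obtain ⟨⟨x, y⟩, h⟩ := e
  obtain ⟨i, u, v, huv, rfl, rfl⟩ := glueCopies_adj.1 h
  exact ⟨i, ⟨s(u, v), huv⟩, rfl⟩

/-- The edge shared by all copies. -/
def glueEdge (hab : H.Adj a b) (hk : 0 < k) : (glueCopies H a b k).edgeSet :=
  ⟨s(Sum.inl 0, Sum.inl 1), glueCopies_adj.2
    ⟨⟨0, hk⟩, a, b, hab, glueInclusion_left _, glueInclusion_right hab.ne _⟩⟩

lemma mapEdgeSet_glueHom (hab : H.Adj a b) (hk : 0 < k) (i : Fin k) :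
    (glueHom H a b k i).mapEdgeSet ⟨s(a, b), hab⟩ = glueEdge hab hk := by
  apply Subtype.ext
  change s(glueInclusion a b k i a, glueInclusion a b k i b) = s(_, _)
  rw [glueInclusion_left, glueInclusion_right hab.ne]

/-- Labellings of the copies that agree on whether `a` and `b` have the same label can be glued. -/
lemma exists_glued_labelling (hab : a ≠ b) (h : Fin k → V → ℕ) (P : Prop)
    (hP : ∀ i, h i a = h i b ↔ P) :
    ∃ F : GlueVertex a b k → ℕ, ∀ i u v,
      F (glueInclusion a b k i u) = F (glueInclusion a b k i v) ↔ h i u = h i v := by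
  classical
  -- The classes of `a` and `b` get labels common to all copies; every other class is tagged with
  -- its copy, so different copies cannot interfere.
  let L : Fin k → V → Bool ⊕ (Fin k × ℕ) := fun i x =>
    if h i x = h i a then Sum.inl true else if h i x = h i b then Sum.inl false
    else Sum.inr (i, h i x)
  have hL : ∀ i u v, L i u = L i v ↔ h i u = h i v := by
    intro i u v
    simp only [L]
    split_ifs <;> simp <;> grind
  let F : GlueVertex a b k → Bool ⊕ (Fin k × ℕ) := fun x => match x with
    | Sum.inl s => if s = 0 ∨ P then Sum.inl true else Sum.inl false
    | Sum.inr (i, x) => L i x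
  have hF : ∀ i u, F (glueInclusion a b k i u) = L i u := by
    intro i u
    by_cases ha : u = a
    · subst ha
      rw [glueInclusion_left]
      simp [F, L]
    by_cases hb : u = b
    · subst hb
      rw [glueInclusion_right hab]
      have := hP i
      simp only [F, L, ← this, eq_comm (a := h i u)]
      simp
    · rw [glueInclusion_of_ne i ⟨ha, hb⟩]
  obtain ⟨E, hE⟩ := exists_injective_nat (Bool ⊕ (Fin k × ℕ))
  exact ⟨E ∘ F, fun i u v => by
    rw [Function.comp_apply, Function.comp_apply, hE.eq_iff, hF, hF, hL]⟩

/-- Restriction to the copies is a bijection onto `k`-tuples: once the shared edge has a fixed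
colour, the labellings of the copies agree on whether `a` and `b` share a label, so they glue. -/
lemma goodCount_glueCopies (hab : H.Adj a b) (hk : 0 < k) :
    goodCount (glueCopies H a b k) (glueEdge hab hk) = goodCount H ⟨s(a, b), hab⟩ ^ k := by
  let R : {c : (glueCopies H a b k).edgeSet → Bool |
      IsGoodColouring c ∧ c (glueEdge hab hk) = true} →
      Fin k → {c : H.edgeSet → Bool | IsGoodColouring c ∧ c ⟨s(a, b), hab⟩ = true} :=
    fun c i => ⟨c.1 ∘ (glueHom H a b k i).mapEdgeSet, c.2.1.comp_hom _, by
      rw [Function.comp_apply, mapEdgeSet_glueHom hab hk, c.2.2]⟩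
  have hR : Function.Bijective R := by
    constructor
    · intro c d hcd
      refine Subtype.ext (funext fun e => ?_)
      obtain ⟨i, f, rfl⟩ := exists_edge_eq e
      exact congrFun (congrArg Subtype.val (congrFun hcd i)) f
    · intro C
      choose f hf using fun i => (C i).2.1 true
      choose g hg using fun i => (C i).2.1 false
      -- As `ab` is red, the labellings for red identify `a` and `b`, while those for blue separate
      -- them.
      obtain ⟨F, hF⟩ := exists_glued_labelling hab.ne f True fun i => by
        rw [← hf i a b hab]
        simpa using (C i).2.2
      obtain ⟨G, hG⟩ := exists_glued_labelling hab.ne g False fun i => by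
        rw [← hg i a b hab, (C i).2.2]
        simp
      classical
      let c : (glueCopies H a b k).edgeSet → Bool := fun e =>
        decide (∀ x y, s(x, y) = e.1 → F x = F y)
      have hc : ∀ x y h, c ⟨s(x, y), h⟩ = true ↔ F x = F y := by
        intro x y h
        simp only [c, decide_eq_true_eq]
        refine ⟨fun h => h x y rfl, fun h x' y' h' => ?_⟩
        rcases Sym2.eq_iff.1 h' with ⟨rfl, rfl⟩ | ⟨rfl, rfl⟩
        · exact h
        · exact h.symm
      have hcC : ∀ i e, c ((glueHom H a b k i).mapEdgeSet e) = (C i).1 e := by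
        rintro i ⟨⟨u, v⟩, h⟩
        rw [Bool.eq_iff_iff]
        exact (hc _ _ _).trans ((hF i u v).trans (hf i u v h).symm)
      have hgood : IsGoodColouring c := by
        intro b'
        cases b'
        · refine ⟨G, fun x y h => ?_⟩
          obtain ⟨i, u, v, huv, rfl, rfl⟩ := glueCopies_adj.1 h
          rw [hG, ← hg i u v huv, ← hcC]
          rfl
        · exact ⟨F, hc⟩
      refine ⟨⟨c, hgood, ?_⟩, ?_⟩
      · rw [← mapEdgeSet_glueHom hab hk ⟨0, hk⟩, hcC]
        exact (C _).2.2
      · funext i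
        exact Subtype.ext (funext fun e => hcC i e)
  rw [goodCount, goodCount, ← Nat.card_coe_set_eq, ← Nat.card_coe_set_eq,
    Nat.card_congr (Equiv.ofBijective R hR), Nat.card_fun, Nat.card_fin]

lemma nnac_glueCopies [Finite V] (hab : H.Adj a b) (hk : 0 < k) :
    nnac (glueCopies H a b k) = (nnac H + 1) ^ k - 1 := by
  have := nnac_add_one (glueEdge hab hk)
  rw [goodCount_glueCopies, Nat.cast_pow, ← nnac_add_one] at this
  linarith

lemma card_glueVertex [Fintype V] (hab : a ≠ b) :
    Fintype.card (GlueVertex a b k) = 2 + k * (Fintype.card V - 2) := by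
  have h : Fintype.card {x : V // x ≠ a ∧ x ≠ b} = Fintype.card V - 2 := by
    rw [Fintype.card_subtype, ← Finset.card_pair hab, ← Finset.card_univ,
      ← Finset.card_sdiff_of_subset (Finset.subset_univ _)]
    congr 1
    ext x
    simp
  simp [h]

lemma ncard_edgeSet_glueCopies [Finite V] (hab : H.Adj a b) (hk : 0 < k) :
    (glueCopies H a b k).edgeSet.ncard = 1 + k * (H.edgeSet.ncard - 1) := by
  let ι := fun i => Sym2.map (glueInclusion a b k i)
  have hι : ∀ i, Function.Injective (ι i) := fun i =>
    Sym2.map.injective (glueInclusion_injective i)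
  let S := H.edgeSet \ {s(a, b)}
  let T := (glueCopies H a b k).edgeSet \ {s(Sum.inl 0, Sum.inl 1)}
  have hιab : ∀ i, ι i s(a, b) = s(Sum.inl 0, Sum.inl 1) := fun i => by
    simp [ι, glueInclusion_left, glueInclusion_right hab.ne]
  let R : Fin k × S → T := fun x => ⟨ι x.1 x.2, by
    refine ⟨((glueHom H a b k x.1).mapEdgeSet ⟨x.2.1, x.2.2.1⟩).2, ?_⟩
    rw [Set.mem_singleton_iff, ← hιab x.1, (hι _).eq_iff]
    exact x.2.2.2⟩
  -- An endpoint outside `{a, b}` reveals the copy to which an edge belongs, so only `ab` is shared.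
  have hvert : ∀ e ∈ S, ∃ v ∈ e, v ≠ a ∧ v ≠ b := by
    intro e
    induction e with | _ x y
    rintro ⟨h, hne⟩
    by_contra! hcon
    have hx := hcon x (by simp)
    have hy := hcon y (by simp)
    have hxy : x ≠ y := SimpleGraph.Adj.ne h
    apply hne
    rw [Set.mem_singleton_iff, Sym2.eq_iff]
    grind
  have hR : Function.Bijective R := by
    constructor
    · rintro ⟨i, e, he⟩ ⟨j, f, hf⟩ h
      have h' : ι i e = ι j f := congrArg Subtype.val h
      have hij : i = j := by
        obtain ⟨v, hv, hvab⟩ := hvert e he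
        have h1 : glueInclusion a b k i v ∈ ι j f := h' ▸ Sym2.mem_map.2 ⟨v, hv, rfl⟩
        obtain ⟨w, -, hw⟩ := Sym2.mem_map.1 h1
        rw [glueInclusion_of_ne i hvab] at hw
        unfold glueInclusion at hw
        split_ifs at hw
        simp at hw
        exact hw.1.symm
      subst hij
      have := hι i h'
      subst this
      rfl
    · rintro ⟨e, he, hne⟩
      obtain ⟨i, f, hf⟩ := exists_edge_eq ⟨e, he⟩
      have hf' : ι i f = e := congrArg Subtype.val hf
      refine ⟨⟨i, f.1, f.2, fun h => hne ?_⟩, Subtype.ext hf'⟩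
      rw [Set.mem_singleton_iff] at h ⊢
      rw [← hf', h, hιab]
  have h1 := Nat.card_congr (Equiv.ofBijective R hR)
  rw [Nat.card_prod, Nat.card_fin, Nat.card_coe_set_eq, Nat.card_coe_set_eq] at h1
  have h2 := Set.ncard_sdiff_singleton_add_one (s := H.edgeSet) (a := s(a, b)) hab (Set.toFinite _)
  have h3 := Set.ncard_sdiff_singleton_add_one (glueEdge hab hk).2 (Set.toFinite _)
  change T.ncard + 1 = _ at h3
  rw [← h3, ← h1, ← h2, add_comm, Nat.add_sub_cancel]

/-- Gluing copies of a minimally rigid graph along an edge preserves minimal rigidity. -/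
lemma isMinimallyRigid_glueCopies [Fintype V] (hab : H.Adj a b) (hk : 0 < k)
    (hcard : H.edgeSet.ncard + 3 = 2 * Fintype.card V)
    (hH : ∀ p : Realisation V 2, GenericRealisation p → IsPinnedRigid H a b p) :
    IsMinimallyRigid (glueCopies H a b k) := by
  refine isMinimallyRigid_of_isPinnedRigid (a := Sum.inl 0) (b := Sum.inl 1)
    (glueEdge hab hk).2 ?_ ?_
  · rw [ncard_edgeSet_glueCopies hab hk, card_glueVertex hab.ne]
    obtain ⟨m, hm⟩ : ∃ m, Fintype.card V = m + 2 :=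
      ⟨Fintype.card V - 2, by
        have := Fintype.one_lt_card_iff.2 ⟨a, b, hab.ne⟩
        omega⟩
    have : H.edgeSet.ncard = 2 * m + 1 := by omega
    rw [this, hm]
    simp only [Nat.add_sub_cancel]
    ring
  · intro p hp q h0 h1 hq
    -- Each copy inherits a generic realisation and has the same two pinned vertices.
    have hcopy : ∀ i : Fin k, q ∘ glueInclusion a b k i = 0 := by
      intro i
      refine hH (p ∘ glueInclusion a b k i) ?_ _ ?_ ?_ fun u v huv => ?_
      · exact AlgebraicIndependent.comp hp (Prod.map (glueInclusion a b k i) id)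
          ((glueInclusion_injective i).prodMap Function.injective_id)
      · rw [Function.comp_apply, glueInclusion_left, h0]
      · rw [Function.comp_apply, glueInclusion_right hab.ne, h1]
      · exact hq _ _ ((glueHom H a b k i).map_adj huv)
    funext x
    obtain ⟨i, v, rfl⟩ := exists_glueInclusion_eq hab.ne ⟨0, hk⟩ x
    exact congrFun (hcopy i) v

end Glue

/-! ### Counting choices by intersecting bit masks. -/

section MaskCounting

/-- `k a b` counts the `d` with `a &&& A d ≠ 0` and `b &&& B d ≠ 0`. -/
def CountsMasks {D : Type} [Fintype D] (A B : D → ℕ) (k : ℕ → ℕ → ℕ) : Prop :=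
  ∀ a b, k a b = ∑ d : D, if a &&& A d ≠ 0 ∧ b &&& B d ≠ 0 then 1 else 0

/-- Extend a counting function by the choice of one element of a list, pruning zero masks. -/
def maskStep {C : Type} (l : List C) (m n : C → ℕ) (k : ℕ → ℕ → ℕ) : ℕ → ℕ → ℕ
  | 0, _ => 0
  | _ + 1, 0 => 0
  | a + 1, b + 1 => l.foldr (fun c s => k ((a + 1) &&& m c) ((b + 1) &&& n c) + s) 0

lemma CountsMasks.maskStep {C D : Type} [Fintype C] [Fintype D] [DecidableEq C] {A B : D → ℕ}
    {k : ℕ → ℕ → ℕ} (h : CountsMasks A B k) {l : List C} (hl : l.Nodup) (hmem : ∀ c, c ∈ l)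
    (m n : C → ℕ) :
    CountsMasks (fun x : C × D => m x.1 &&& A x.2) (fun x => n x.1 &&& B x.2)
      (maskStep l m n k) := by
  intro a b
  rcases a with _ | a
  · simp [_root_.maskStep]
  rcases b with _ | b
  · simp [_root_.maskStep]
  have hsum : ∀ F : C → ℕ, l.foldr (fun c s => F c + s) 0 = ∑ c, F c := by
    intro F
    have hu : (Finset.univ : Finset C) = l.toFinset := by
      ext c; simp [hmem c]
    rw [hu, List.sum_toFinset _ hl]
    clear hu hl hmem
    induction l with
    | nil => rfl
    | cons c l ih => simp [ih]
  rw [_root_.maskStep, hsum fun c => k ((a + 1) &&& m c) ((b + 1) &&& n c), Fintype.sum_prod_type]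
  refine Finset.sum_congr rfl fun c _ => ?_
  rw [h]
  simp only [Nat.land_assoc]

/-- The mask of the numbers below `120` with the property `P`. -/
def mask (P : ℕ → Bool) : ℕ := Nat.ofBits fun i : Fin 120 => P i

lemma testBit_mask (P : ℕ → Bool) (i : ℕ) : (mask P).testBit i = (decide (i < 120) && P i) := by
  by_cases h : i < 120
  · simp [mask, h, Nat.testBit_ofBits_lt]
  · simp [mask, h, Nat.testBit_ofBits_ge _ _ (not_lt.1 h)]

lemma ne_zero_iff_exists_testBit (n : ℕ) : n ≠ 0 ↔ ∃ i, n.testBit i = true :=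
  ⟨Nat.exists_testBit_of_ne_zero, fun ⟨i, hi⟩ h => by simp [h] at hi⟩

end MaskCounting

/-! ### Reducing labellings of the base graph to the vertices 1, 3, 5, 8, 9. -/

section BaseCount

/-- Whether the edges of colours `c` and `d` from a vertex to two others are consistent, where `e`
says whether the latter have the same label. -/
def pairOk (c d e : Bool) : Bool := if c == d then !c || e else !e

/-- Whether a vertex with edges of colours `c` to three vertices `x`, `y`, `z` can be labelled,
where `exy`, `exz`, `eyz` say which of these have the same label. -/
def vertexOk (c : Bool × Bool × Bool) (exy exz eyz : Bool) : Bool :=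
  pairOk c.1 c.2.1 exy && pairOk c.1 c.2.2 exz && pairOk c.2.1 c.2.2 eyz

/-- The same for two adjacent vertices, one joined to `x` and `y`, the other to `z`. -/
def gadgetOk (c : Bool × Bool × Bool × Bool) (exy exz eyz : Bool) : Bool :=
  if c.2.2.1 || c.2.2.2 then vertexOk (c.1, c.2.1, c.2.2.1 && c.2.2.2) exy exz eyz
  else pairOk c.1 c.2.1 exy

/-- Pairwise consistency suffices: a red edge forces the label, and with no red edge `x + y + z + 1`
differs from all three. -/
lemma vertexOk_iff (c : Bool × Bool × Bool) (x y z : ℕ) :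
    vertexOk c (decide (x = y)) (decide (x = z)) (decide (y = z)) = true ↔
      ∃ l : ℕ, (c.1 = true ↔ l = x) ∧ (c.2.1 = true ↔ l = y) ∧ (c.2.2 = true ↔ l = z) := by
  obtain ⟨c, d, e⟩ := c
  constructor
  · intro h
    refine ⟨if c then x else if d then y else if e then z else x + y + z + 1, ?_⟩
    cases c <;> cases d <;> cases e <;> simp [vertexOk, pairOk] at h ⊢ <;> omega
  · rintro ⟨l, h⟩
    cases c <;> cases d <;> cases e <;> simp [vertexOk, pairOk] at h ⊢ <;> omega

/-- The path from `l` through `m` to `z` acts like one edge: two red edges force `l = z`, exactly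
one forces `l ≠ z`, and with none `m` can be chosen fresh, so `z` imposes nothing. -/
lemma gadgetOk_iff (c : Bool × Bool × Bool × Bool) (x y z : ℕ) :
    gadgetOk c (decide (x = y)) (decide (x = z)) (decide (y = z)) = true ↔
      ∃ l m : ℕ, (c.1 = true ↔ l = x) ∧ (c.2.1 = true ↔ l = y) ∧ (c.2.2.1 = true ↔ m = l) ∧
        (c.2.2.2 = true ↔ m = z) := by
  obtain ⟨c, d, e, f⟩ := c
  constructor
  · intro h
    obtain ⟨l, hl⟩ : ∃ l : ℕ, l = if c then x else if d then y else if e && f then z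
      else x + y + z + 1 := ⟨_, rfl⟩
    refine ⟨l, if e then l else if f then z else l + z + 1, ?_⟩
    cases c <;> cases d <;> cases e <;> cases f <;>
      simp [gadgetOk, vertexOk, pairOk] at h hl ⊢ <;> omega
  · rintro ⟨l, m, h⟩
    cases c <;> cases d <;> cases e <;> cases f <;>
      simp [gadgetOk, vertexOk, pairOk] at h ⊢ <;> omega

/-- The edges of the base graph, grouped around the vertices `1, 3, 5, 8, 9`. -/
def baseEdge : Fin 33 → Fin 18 × Fin 18 :=
  ![(3, 8), (2, 1), (2, 3), (2, 5), (4, 1), (4, 3), (4, 5), (11, 1), (11, 3), (11, 5), (8, 9),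
    (0, 1), (0, 5), (0, 9), (10, 1), (10, 5), (10, 9), (12, 1), (12, 5), (13, 12), (13, 8),
    (14, 1), (14, 5), (15, 14), (15, 8), (16, 1), (16, 5), (17, 16), (17, 8), (6, 1), (6, 5),
    (7, 6), (7, 8)]

lemma baseGraph_adj_baseEdge (i : Fin 33) : baseGraph.Adj (baseEdge i).1 (baseEdge i).2 := by
  revert i; decide +kernel

/-- The enumeration of the edges of the base graph. -/
noncomputable def baseEdgeEquiv : Fin 33 ≃ baseGraph.edgeSet :=
  Equiv.ofBijective (fun i => ⟨s((baseEdge i).1, (baseEdge i).2), baseGraph_adj_baseEdge i⟩) <| by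
    constructor
    · intro i j h
      have h' : s((baseEdge i).1, (baseEdge i).2) = s((baseEdge j).1, (baseEdge j).2) :=
        congrArg Subtype.val h
      revert i j
      decide +kernel
    · rintro ⟨⟨u, v⟩, h⟩
      have : ∀ u v, baseGraph.Adj u v → ∃ i, s((baseEdge i).1, (baseEdge i).2) = s(u, v) := by
        decide +kernel
      obtain ⟨i, hi⟩ := this u v h
      exact ⟨i, Subtype.ext hi⟩

/-- Colourings of the base graph, split into the groups of `baseEdge`. -/
abbrev BaseColouring : Type :=
  Bool × (Bool × Bool × Bool) × (Bool × Bool × Bool) × (Bool × Bool × Bool) × Bool ×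
    (Bool × Bool × Bool) × (Bool × Bool × Bool) × (Bool × Bool × Bool × Bool) ×
    (Bool × Bool × Bool × Bool) × (Bool × Bool × Bool × Bool) × (Bool × Bool × Bool × Bool) × Unit

/-- The bijection between the two presentations of a colouring. -/
def splitColouring : (Fin 33 → Bool) ≃ BaseColouring where
  toFun d := (d 0, (d 1, d 2, d 3), (d 4, d 5, d 6), (d 7, d 8, d 9), d 10, (d 11, d 12, d 13),
    (d 14, d 15, d 16), (d 17, d 18, d 19, d 20), (d 21, d 22, d 23, d 24),
    (d 25, d 26, d 27, d 28), (d 29, d 30, d 31, d 32), ())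
  invFun x := match x with
    | (a0, (a1, a2, a3), (a4, a5, a6), (a7, a8, a9), a10, (a11, a12, a13), (a14, a15, a16),
        (a17, a18, a19, a20), (a21, a22, a23, a24), (a25, a26, a27, a28), (a29, a30, a31, a32),
        ()) =>
      ![a0, a1, a2, a3, a4, a5, a6, a7, a8, a9, a10, a11, a12, a13, a14, a15, a16, a17, a18, a19,
        a20, a21, a22, a23, a24, a25, a26, a27, a28, a29, a30, a31, a32]
  left_inv d := by
    funext i
    fin_cases i <;> rfl
  right_inv _ := rfl

/-- Whether the labels `n₁`, `n₃`, `n₅`, `n₈`, `n₉` of `1, 3, 5, 8, 9` extend to a labelling of all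
vertices for which the edges of colour `true` are those joining vertices with the same label. -/
def LabelsOk (x : BaseColouring) (n₁ n₃ n₅ n₈ n₉ : ℕ) : Prop :=
  match x with
  | (c, v₂, v₄, v₁₁, d, v₀, v₁₀, g, g', g'', g''', _) =>
    (c = decide (n₃ = n₈)) ∧
    vertexOk v₂ (decide (n₁ = n₃)) (decide (n₁ = n₅)) (decide (n₃ = n₅)) ∧
    vertexOk v₄ (decide (n₁ = n₃)) (decide (n₁ = n₅)) (decide (n₃ = n₅)) ∧
    vertexOk v₁₁ (decide (n₁ = n₃)) (decide (n₁ = n₅)) (decide (n₃ = n₅)) ∧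
    (d = decide (n₈ = n₉)) ∧
    vertexOk v₀ (decide (n₁ = n₅)) (decide (n₁ = n₉)) (decide (n₅ = n₉)) ∧
    vertexOk v₁₀ (decide (n₁ = n₅)) (decide (n₁ = n₉)) (decide (n₅ = n₉)) ∧
    gadgetOk g (decide (n₁ = n₅)) (decide (n₁ = n₈)) (decide (n₅ = n₈)) ∧
    gadgetOk g' (decide (n₁ = n₅)) (decide (n₁ = n₈)) (decide (n₅ = n₈)) ∧
    gadgetOk g'' (decide (n₁ = n₅)) (decide (n₁ = n₈)) (decide (n₅ = n₈)) ∧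
    gadgetOk g''' (decide (n₁ = n₅)) (decide (n₁ = n₈)) (decide (n₅ = n₈))

lemma exists_labelling_iff (d : Fin 33 → Bool) :
    (∃ f : Fin 18 → ℕ, ∀ i, d i = true ↔ f (baseEdge i).1 = f (baseEdge i).2) ↔
      ∃ n₁ n₃ n₅ n₈ n₉, LabelsOk (splitColouring d) n₁ n₃ n₅ n₈ n₉ := by
  simp only [LabelsOk, splitColouring, vertexOk_iff, gadgetOk_iff]
  constructor
  · rintro ⟨f, hf⟩
    refine ⟨f 1, f 3, f 5, f 8, f 9, ?_, ⟨f 2, hf 1, hf 2, hf 3⟩, ⟨f 4, hf 4, hf 5, hf 6⟩,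
      ⟨f 11, hf 7, hf 8, hf 9⟩, ?_, ⟨f 0, hf 11, hf 12, hf 13⟩, ⟨f 10, hf 14, hf 15, hf 16⟩,
      ⟨f 12, f 13, hf 17, hf 18, hf 19, hf 20⟩, ⟨f 14, f 15, hf 21, hf 22, hf 23, hf 24⟩,
      ⟨f 16, f 17, hf 25, hf 26, hf 27, hf 28⟩, ⟨f 6, f 7, hf 29, hf 30, hf 31, hf 32⟩⟩
    · rw [Bool.eq_iff_iff, decide_eq_true_eq]; exact hf 0
    · rw [Bool.eq_iff_iff, decide_eq_true_eq]; exact hf 10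
  · rintro ⟨n₁, n₃, n₅, n₈, n₉, h0, ⟨l₂, h1, h2, h3⟩, ⟨l₄, h4, h5, h6⟩, ⟨l₁₁, h7, h8, h9⟩, h10,
      ⟨l₀, h11, h12, h13⟩, ⟨l₁₀, h14, h15, h16⟩, ⟨l₁₂, l₁₃, h17, h18, h19, h20⟩,
      ⟨l₁₄, l₁₅, h21, h22, h23, h24⟩, ⟨l₁₆, l₁₇, h25, h26, h27, h28⟩,
      ⟨l₆, l₇, h29, h30, h31, h32⟩⟩
    rw [Bool.eq_iff_iff, decide_eq_true_eq] at h0 h10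
    refine ⟨![l₀, n₁, l₂, n₃, l₄, n₅, l₆, l₇, n₈, n₉, l₁₀, l₁₁, l₁₂, l₁₃, l₁₄, l₁₅, l₁₆, l₁₇],
      fun i => ?_⟩
    fin_cases i <;> assumption

/-- Replace each label by the position of its first occurrence in the order `1, 3, 5, 8, 9`, which
gives the bounds 2, 3, 4, 5. -/
lemma exists_normal_labels (n₁ n₃ n₅ n₈ n₉ : ℕ) :
    ∃ r₃ r₅ r₈ r₉ : ℕ, (r₃ < 2 ∧ r₅ < 3 ∧ r₈ < 4 ∧ r₉ < 5) ∧
      ((0 = r₃ ↔ n₁ = n₃) ∧ (0 = r₅ ↔ n₁ = n₅) ∧ (0 = r₈ ↔ n₁ = n₈) ∧ (0 = r₉ ↔ n₁ = n₉) ∧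
      (r₃ = r₅ ↔ n₃ = n₅) ∧ (r₃ = r₈ ↔ n₃ = n₈) ∧ (r₅ = r₈ ↔ n₅ = n₈) ∧ (r₅ = r₉ ↔ n₅ = n₉) ∧
      (r₈ = r₉ ↔ n₈ = n₉)) := by
  refine ⟨if n₁ = n₃ then 0 else 1, if n₁ = n₅ then 0 else if n₃ = n₅ then 1 else 2,
    if n₁ = n₈ then 0 else if n₃ = n₈ then 1 else if n₅ = n₈ then 2 else 3,
    if n₁ = n₉ then 0 else if n₃ = n₉ then 1 else if n₅ = n₉ then 2 else if n₈ = n₉ then 3 else 4,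
    ⟨?_, ?_, ?_, ?_⟩, ?_, ?_, ?_, ?_, ?_, ?_, ?_, ?_, ?_⟩ <;> grind

/-- All labels of the vertices `1, 3, 5, 8, 9` can be taken from a list of length `120`. -/
lemma exists_labelsOk_iff (x : BaseColouring) :
    (∃ n₁ n₃ n₅ n₈ n₉, LabelsOk x n₁ n₃ n₅ n₈ n₉) ↔
      ∃ s < 120, LabelsOk x 0 (s % 2) (s / 2 % 3) (s / 6 % 4) (s / 24) := by
  constructor
  · rintro ⟨n₁, n₃, n₅, n₈, n₉, h⟩
    obtain ⟨r₃, r₅, r₈, r₉, ⟨h3, h5, h8, h9⟩, e1, e2, e3, e4, e5, e6, e7, e8, e9⟩ :=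
      exists_normal_labels n₁ n₃ n₅ n₈ n₉
    -- Mixed-radix encoding of the four labels; the length of the list is 120 = 2 · 3 · 4 · 5.
    refine ⟨r₃ + 2 * r₅ + 6 * r₈ + 24 * r₉, by omega, ?_⟩
    rw [show (r₃ + 2 * r₅ + 6 * r₈ + 24 * r₉) % 2 = r₃ by omega,
      show (r₃ + 2 * r₅ + 6 * r₈ + 24 * r₉) / 2 % 3 = r₅ by omega,
      show (r₃ + 2 * r₅ + 6 * r₈ + 24 * r₉) / 6 % 4 = r₈ by omega,
      show (r₃ + 2 * r₅ + 6 * r₈ + 24 * r₉) / 24 = r₉ by omega]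
    simpa only [LabelsOk, e1, e2, e3, e4, e5, e6, e7, e8, e9] using h
  · rintro ⟨s, -, h⟩
    exact ⟨_, _, _, _, _, h⟩

end BaseCount

/-! ### The number of NAC-colourings of the base graph. -/

section BaseCount

/-- The labels for which an edge `{3, 8}` of colour `c` is correct. -/
def mask38 (c : Bool) : ℕ := mask fun s => c == decide (s % 2 = s / 6 % 4)

/-- The labels for which an edge `{8, 9}` of colour `c` is correct. -/
def mask89 (c : Bool) : ℕ := mask fun s => c == decide (s / 6 % 4 = s / 24)

/-- The labels for which a vertex with neighbours `1`, `3`, `5` can be labelled. -/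
def mask135 (c : Bool × Bool × Bool) : ℕ := mask fun s =>
  vertexOk c (decide (0 = s % 2)) (decide (0 = s / 2 % 3)) (decide (s % 2 = s / 2 % 3))

/-- The labels for which a vertex with neighbours `1`, `5`, `9` can be labelled. -/
def mask159 (c : Bool × Bool × Bool) : ℕ := mask fun s =>
  vertexOk c (decide (0 = s / 2 % 3)) (decide (0 = s / 24)) (decide (s / 2 % 3 = s / 24))

/-- The labels for which a gadget attached to `1`, `5`, `8` can be labelled. -/
def mask158 (c : Bool × Bool × Bool × Bool) : ℕ := mask fun s =>
  gadgetOk c (decide (0 = s / 2 % 3)) (decide (0 = s / 6 % 4)) (decide (s / 2 % 3 = s / 6 % 4))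

/-- The labels compatible with a colouring of the base graph. -/
def flatMask : BaseColouring → ℕ
  | (c, v₂, v₄, v₁₁, d, v₀, v₁₀, g, g', g'', g''', _) =>
    mask38 c &&& (mask135 v₂ &&& (mask135 v₄ &&& (mask135 v₁₁ &&& (mask89 d &&& (mask159 v₀ &&&
      (mask159 v₁₀ &&& (mask158 g &&& (mask158 g' &&& (mask158 g'' &&& (mask158 g''' &&&
        mask fun _ => true))))))))))

/-- Bit `s` survives the intersection exactly when the label pattern encoded by `s` meets every
constraint. -/
lemma land_flatMask_ne_zero_iff (x : BaseColouring) :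
    mask (fun _ => true) &&& flatMask x ≠ 0 ↔
      ∃ n₁ n₃ n₅ n₈ n₉, LabelsOk x n₁ n₃ n₅ n₈ n₉ := by
  rw [exists_labelsOk_iff, ne_zero_iff_exists_testBit]
  refine exists_congr fun s => ?_
  obtain ⟨c, v₂, v₄, v₁₁, d, v₀, v₁₀, g, g', g'', g''', _⟩ := x
  simp only [flatMask, LabelsOk, mask38, mask89, mask135, mask159, mask158, Nat.testBit_land,
    testBit_mask, Bool.and_eq_true, decide_eq_true_eq, beq_iff_eq]
  tauto

/-- Swap the two colours at a vertex. -/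
def swap₃ (c : Bool × Bool × Bool) : Bool × Bool × Bool := (!c.1, !c.2.1, !c.2.2)

/-- Swap the two colours in a gadget. -/
def swap₄ (c : Bool × Bool × Bool × Bool) : Bool × Bool × Bool × Bool :=
  (!c.1, !c.2.1, !c.2.2.1, !c.2.2.2)

/-- Swap the two colours. -/
def swapColours : BaseColouring → BaseColouring
  | (c, v₂, v₄, v₁₁, d, v₀, v₁₀, g, g', g'', g''', _) =>
    (!c, swap₃ v₂, swap₃ v₄, swap₃ v₁₁, !d, swap₃ v₀, swap₃ v₁₀, swap₄ g, swap₄ g', swap₄ g'',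
      swap₄ g''', ())

/-- All colourings of three edges. -/
def colours₃ : List (Bool × Bool × Bool) :=
  [(true, true, true), (true, true, false), (true, false, true), (true, false, false),
    (false, true, true), (false, true, false), (false, false, true), (false, false, false)]

/-- All colourings of four edges. -/
def colours₄ : List (Bool × Bool × Bool × Bool) :=
  colours₃.map (Prod.mk true) ++ colours₃.map (Prod.mk false)

/-- The recursion that counts the good colourings of the base graph. -/
def baseCounter : ℕ → ℕ → ℕ :=
  maskStep [true, false] mask38 (fun c => mask38 !c) <|
  maskStep colours₃ mask135 (fun c => mask135 (swap₃ c)) <|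
  maskStep colours₃ mask135 (fun c => mask135 (swap₃ c)) <|
  maskStep colours₃ mask135 (fun c => mask135 (swap₃ c)) <|
  maskStep [true, false] mask89 (fun c => mask89 !c) <|
  maskStep colours₃ mask159 (fun c => mask159 (swap₃ c)) <|
  maskStep colours₃ mask159 (fun c => mask159 (swap₃ c)) <|
  maskStep colours₄ mask158 (fun c => mask158 (swap₄ c)) <|
  maskStep colours₄ mask158 (fun c => mask158 (swap₄ c)) <|
  maskStep colours₄ mask158 (fun c => mask158 (swap₄ c)) <|
  maskStep colours₄ mask158 (fun c => mask158 (swap₄ c)) <|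
  fun a b => if a &&& (mask fun _ => true) ≠ 0 ∧ b &&& (mask fun _ => true) ≠ 0 then 1 else 0

lemma countsMasks_baseCounter :
    CountsMasks flatMask (fun x => flatMask (swapColours x)) baseCounter := by
  have h2 : [true, false].Nodup := by decide
  have h2' : ∀ c, c ∈ [true, false] := by decide
  have h3 : colours₃.Nodup := by decide
  have h3' : ∀ c, c ∈ colours₃ := by decide
  have h4 : colours₄.Nodup := by decide
  have h4' : ∀ c, c ∈ colours₄ := by decide
  have h0 : CountsMasks (fun _ : Unit => mask fun _ => true) (fun _ : Unit => mask fun _ => true)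
      fun a b => if a &&& (mask fun _ => true) ≠ 0 ∧ b &&& (mask fun _ => true) ≠ 0 then 1 else 0 :=
    fun a b => by simp
  exact ((((((((((h0.maskStep h4 h4' mask158 (fun c => mask158 (swap₄ c))).maskStep h4 h4'
    mask158 (fun c => mask158 (swap₄ c))).maskStep h4 h4'
    mask158 (fun c => mask158 (swap₄ c))).maskStep h4 h4'
    mask158 (fun c => mask158 (swap₄ c))).maskStep h3 h3'
    mask159 (fun c => mask159 (swap₃ c))).maskStep h3 h3'
    mask159 (fun c => mask159 (swap₃ c))).maskStep h2 h2'
    mask89 (fun c => mask89 !c)).maskStep h3 h3'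
    mask135 (fun c => mask135 (swap₃ c))).maskStep h3 h3'
    mask135 (fun c => mask135 (swap₃ c))).maskStep h3 h3'
    mask135 (fun c => mask135 (swap₃ c))).maskStep h2 h2' mask38 (fun c => mask38 !c)

/-- Pruning makes this a feasible evaluation instead of a search through 2 ^ 33 colourings. -/
lemma baseCounter_eq : baseCounter (mask fun _ => true) (mask fun _ => true) = 361216 := by
  decide +kernel

lemma isFlat_iff_of_baseEdge (c : baseGraph.edgeSet → Bool) (b : Bool) :
    IsFlat c b ↔ ∃ f : Fin 18 → ℕ, ∀ i, (c (baseEdgeEquiv i) == b) = true ↔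
      f (baseEdge i).1 = f (baseEdge i).2 := by
  refine exists_congr fun f => ?_
  simp only [beq_iff_eq]
  constructor
  · exact fun h i => h _ _ (baseGraph_adj_baseEdge i)
  · intro h u v huv
    obtain ⟨i, hi⟩ := baseEdgeEquiv.surjective ⟨s(u, v), huv⟩
    rw [← hi, h i]
    have hi' : s((baseEdge i).1, (baseEdge i).2) = s(u, v) := congrArg Subtype.val hi
    rcases Sym2.eq_iff.1 hi' with ⟨h1, h2⟩ | ⟨h1, h2⟩
    · rw [h1, h2]
    · rw [h1, h2, eq_comm]

/-- The masks only test whether the red class is a flat; the blue class is tested on the colouring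
with colours swapped. -/
lemma isGoodColouring_baseGraph_iff (c : baseGraph.edgeSet → Bool) :
    IsGoodColouring c ↔
      mask (fun _ => true) &&& flatMask (splitColouring (c ∘ baseEdgeEquiv)) ≠ 0 ∧
      mask (fun _ => true) &&& flatMask (swapColours (splitColouring (c ∘ baseEdgeEquiv))) ≠ 0 := by
  have hswap : swapColours (splitColouring (c ∘ baseEdgeEquiv)) =
      splitColouring fun i => c (baseEdgeEquiv i) == false := by
    have : (fun i => c (baseEdgeEquiv i) == false) = fun i => !c (baseEdgeEquiv i) := by
      funext i; simp
    rw [this]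
    rfl
  have hid : c ∘ baseEdgeEquiv = fun i => c (baseEdgeEquiv i) == true := by
    funext i; simp
  rw [hswap, hid, land_flatMask_ne_zero_iff, land_flatMask_ne_zero_iff, ← exists_labelling_iff,
    ← exists_labelling_iff, ← isFlat_iff_of_baseEdge, ← isFlat_iff_of_baseEdge, IsGoodColouring,
    Bool.forall_bool, and_comm]

lemma ncard_isGoodColouring_baseGraph :
    {c : baseGraph.edgeSet → Bool | IsGoodColouring c}.ncard = 361216 := by
  rw [← baseCounter_eq, countsMasks_baseCounter, ← Finset.card_filter, ← Fintype.card_subtype,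
    ← Nat.card_eq_fintype_card, ← Nat.card_coe_set_eq]
  exact Nat.card_congr (((baseEdgeEquiv.arrowCongr (Equiv.refl Bool)).symm.trans
    splitColouring).subtypeEquiv isGoodColouring_baseGraph_iff)

lemma nnac_baseGraph : nnac baseGraph = 180607 := by
  let e : baseGraph.edgeSet := baseEdgeEquiv 0
  have h1 := ncard_isGoodColouring_eq_two_mul e
  rw [ncard_isGoodColouring_baseGraph] at h1
  have h2 : goodCount baseGraph e = 180608 := by omega
  have h3 := nnac_add_one e
  rw [h2] at h3
  push_cast at h3
  linarith

end BaseCount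

theorem corollary5p6 :
    IsMinimallyRigid baseGraph ∧ nnac baseGraph = 180607 ∧
      ∀ a b : Fin 18, baseGraph.Adj a b →
        (∀ k : ℕ, 1 ≤ k →
          IsMinimallyRigid (glueCopies baseGraph a b k) ∧
          Fintype.card (GlueVertex a b k) = 16 * k + 2 ∧
          nnac (glueCopies baseGraph a b k) = (nnac baseGraph + 1) ^ k - 1) ∧
        (fun k : ℕ => (2.13 : ℝ) ^ Fintype.card (GlueVertex a b k))
          =o[atTop] (fun k : ℕ => nnac (glueCopies baseGraph a b k)) := by
  refine ⟨isMinimallyRigid_baseGraph, nnac_baseGraph, fun a b hab => ?_⟩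
  have hcard : ∀ k, Fintype.card (GlueVertex a b k) = 16 * k + 2 := fun k => by
    rw [card_glueVertex hab.ne, Fintype.card_fin]
    ring
  refine ⟨fun k hk => ⟨isMinimallyRigid_glueCopies hab hk
    (by rw [ncard_edgeSet_baseGraph]; simp) fun p hp => isPinnedRigid_baseGraph hab hp, hcard k,
    nnac_glueCopies hab hk⟩, ?_⟩
  have h1 : (fun k : ℕ => nnac (glueCopies baseGraph a b k)) =ᶠ[atTop]
      fun k : ℕ => (180608 : ℝ) ^ k - 1 := by
    filter_upwards [eventually_ge_atTop 1] with k hk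
    rw [nnac_glueCopies hab hk, nnac_baseGraph]
    norm_num
  refine IsLittleO.trans_eventuallyEq ?_ h1.symm
  have h2 : (fun k : ℕ => (2.13 : ℝ) ^ Fintype.card (GlueVertex a b k)) =
      fun k : ℕ => (2.13 : ℝ) ^ 2 * ((2.13 : ℝ) ^ 16) ^ k := by
    funext k
    rw [hcard, pow_add, pow_mul, mul_comm]
  rw [h2]
  -- Each copy adds 16 vertices and a factor 180608, and 2.13 ^ 16 is about 179500.
  have h3 : (fun k : ℕ => ((2.13 : ℝ) ^ 16) ^ k) =o[atTop] fun k : ℕ => (180608 : ℝ) ^ k :=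
    isLittleO_pow_pow_of_lt_left (by positivity) (by norm_num)
  have h4 : (fun k : ℕ => (180608 : ℝ) ^ k) =O[atTop] fun k : ℕ => (180608 : ℝ) ^ k - 1 := by
    -- `x ≤ 2 (x - 1)` as soon as `x ≥ 2`.
    refine IsBigO.of_bound 2 ?_
    filter_upwards [eventually_ge_atTop 1] with k hk
    have h5 : (180608 : ℝ) ≤ 180608 ^ k := le_self_pow₀ (by norm_num) (by omega)
    rw [Real.norm_of_nonneg (by positivity), Real.norm_of_nonneg (by linarith)]
    linarith
  exact (h3.const_mul_left _).trans_isBigO h4
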